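/- **Model.** Let $\mathcal Z$ be a compact metric space, $\mu$ a Borel probability measure on $\mathcal Z$, and $n,p\ge 1$. Let $Z_1,\dots,Z_n$ be i.i.d. with law $\mu$; let $X_1,\dots,X_p$ be independent (not necessarily identically distributed), square-integrable, real-valued measurable random fields indexed by $\mathcal Z$; let $\mathbf E\in\mathbb R^{n\times p}$ be a random matrix with zero-mean, unit-variance entries, whose columns are independent and whose entries in distinct rows are uncorrelated. The three sources $(Z_i)$, $(X_j)$, $\mathbf E$ are independent. For $\sigma\ge 0$ put $\mathbf Y_{ij}=X_j(Z_i)+\sigma\mathbf E_{ij}$, so that $\mathbf Y\in\mathbb R^{n\times p}$, and let $f(z,z')=\frac1p\sum_{j=1}^p\mathbb E[X_j(z)X_j(z')]$ be the mean correlation kernel. **Assumptions.** (i) For each $j$, $(z,z')\mapsto\mathbb E[X_j(z)X_j(z')]$ is continuous on $\mathcal Z\times\mathcal Z$. (ii) For some real $q\ge1$, $M_X:=\max_{j}\sup_{z}\mathbb E|X_j(z)|^{4q}<\infty$ and $M_E:=\max_{i,j}\mathbb E|\mathbf E_{ij}|^{4q}<\infty$. (iii) The kernel $f$ has finite rank $r\ge1$: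 it has a Mercer expansion $f(z,z')=\sum_{k\ge1}\lambda_k u_k(z)u_k(z')$, for all $z,z'\in\mathcal Z$, with $u_k$ orthonormal in $L^2(\mu)$, in which $\lambda_1\ge\dots\ge\lambda_r>0$ and $\lambda_k=0$ for $k>r$. Put $\phi(z)=(\lambda_1^{1/2}u_1(z),\dots,\lambda_r^{1/2}u_r(z))^\top\in\mathbb R^r$. **PC scores.** Let $r\le\min\{n,p\}$, let the columns of the random matrix $\mathbf V\in\mathbb R^{p\times r}$ be orthonormal eigenvectors associated with the $r$ largest eigenvalues of $\mathbf Y^\top\mathbf Y$, and let $\zeta_1,\dots,\zeta_n\in\mathbb R^r$ be the rows of $\mathbf Y\mathbf V$. **Theorem.** There are constants $c_1>0$, depending only on $f,\lambda_1,\lambda_r$, and $c_2(q)>0$, depending only on $q,\lambda_1,\lambda_r,M_X,M_E,\sigma^2$, such that the following holds. Under the model and assumptions above there is a random orthogonal matrix $\mathbf Q\in\mathbb R^{r\times r}$ such that for all $\delta\in(0,1)$ and $\epsilon\in(0,1]$: if $$n\ \ge\ c_1\left\{\sigma^2r^{1/2}\left(1\vee\frac{\sigma^2r^{1/2}}{\epsilon^2}\right)\vee\log\frac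 r\delta\right\}\quad\text{and}\quad\frac pn\ \ge\ c_2(q)\,\frac{r}{\delta^{1/q}\epsilon^2},$$ then, with probability at least $1-\delta$, $$\max_{1\le i\le n}\left\|p^{-1/2}\mathbf Q\zeta_i-\phi(Z_i)\right\|_2\le\epsilon .$$ -/

import Mathlib

open MeasureTheory ProbabilityTheory
open scoped ENNReal Matrix

noncomputable section

namespace LatentMetricSpace

/-- The Latent Metric Space model with `n` latent variables, `p` random fields on `𝒵` and an
`n × p` noise matrix: `Z 1, …, Z n` are i.i.d. with law `μ`; the random fields `X 1, …, X p` are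
square-integrable and independent (as random elements of `𝒵 → ℝ`); the noise has centred,
unit-variance entries, independent columns, and uncorrelated entries in distinct rows; and the three
sources of randomness are independent. The fields are measurable random fields: they are jointly
measurable with respect to the Borel σ-algebra of `𝒵` and the σ-algebra `𝓖` which carries the
randomness of the fields, so that `X j (Z i)` is a random variable. -/
structure IsModel {𝒵 Ω : Type*} [MeasurableSpace 𝒵] [mΩ : MeasurableSpace Ω]
    (P : Measure Ω) (μ : Measure 𝒵) {n p : ℕ}
    (Z : Fin n → Ω → 𝒵) (X : Fin p → 𝒵 → Ω → ℝ) (E : Fin n → Fin p → Ω → ℝ) : Prop where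
  measurable_latent : ∀ i, Measurable (Z i)
  law_latent : ∀ i, P.map (Z i) = μ
  indep_latent : iIndepFun Z P
  memLp_field : ∀ j z, MemLp (X j z) 2 P
  indep_field : iIndepFun (fun (j : Fin p) (ω : Ω) (z : 𝒵) => X j z ω) P
  measurable_noise : ∀ i j, Measurable (E i j)
  mean_noise : ∀ i j, ∫ ω, E i j ω ∂P = 0
  variance_noise : ∀ i j, ∫ ω, E i j ω ^ 2 ∂P = 1
  indep_noise_columns : iIndepFun (fun (j : Fin p) (ω : Ω) (i : Fin n) => E i j ω) P
  uncorrelated_noise_rows : ∀ i i', i ≠ i' → ∀ j j', ∫ ω, E i j ω * E i' j' ω ∂P = 0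
  indep_sources : ∃ 𝓖 : MeasurableSpace Ω, 𝓖 ≤ mΩ ∧
    (∀ j, Measurable[MeasurableSpace.prod ‹MeasurableSpace 𝒵› 𝓖]
      (fun a : 𝒵 × Ω => X j a.1 a.2)) ∧
    iIndep ![MeasurableSpace.comap (fun ω i => Z i ω) MeasurableSpace.pi, 𝓖,
      MeasurableSpace.comap (fun ω i j => E i j ω) MeasurableSpace.pi] P

/-- The data matrix `Y i j = X j (Z i) + σ E i j`, of size `n × p`. -/
def dataMatrix {𝒵 Ω : Type*} {n p : ℕ} (σ : ℝ) (Z : Fin n → Ω → 𝒵) (X : Fin p → 𝒵 → Ω → ℝ)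
    (E : Fin n → Fin p → Ω → ℝ) (ω : Ω) : Matrix (Fin n) (Fin p) ℝ :=
  Matrix.of fun i j => X j (Z i ω) ω + σ * E i j ω

/-- The mean correlation kernel `f(z,z') = p⁻¹ ∑ j, 𝔼[X j z * X j z']`. -/
def meanCorrelationKernel {𝒵 Ω : Type*} [MeasurableSpace Ω] (P : Measure Ω) {p : ℕ}
    (X : Fin p → 𝒵 → Ω → ℝ) (z z' : 𝒵) : ℝ :=
  (1 / (p : ℝ)) * ∑ j, ∫ ω, X j z ω * X j z' ω ∂P

/-- `max_j sup_z 𝔼|X j z|^s`, as an extended non-negative real. -/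
def fieldMoment {𝒵 Ω : Type*} [MeasurableSpace Ω] (P : Measure Ω) {p : ℕ}
    (X : Fin p → 𝒵 → Ω → ℝ) (s : ℝ) : ℝ≥0∞ :=
  ⨆ j, ⨆ z, ∫⁻ ω, ‖X j z ω‖ₑ ^ s ∂P

/-- `max_{i,j} 𝔼|E i j|^s`, as an extended non-negative real. -/
def noiseMoment {Ω : Type*} [MeasurableSpace Ω] (P : Measure Ω) {n p : ℕ}
    (E : Fin n → Fin p → Ω → ℝ) (s : ℝ) : ℝ≥0∞ :=
  ⨆ i, ⨆ j, ∫⁻ ω, ‖E i j ω‖ₑ ^ s ∂P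

/-- `(lam k, u k)`, `k = 0, 1, …`, is a Mercer expansion of the kernel `f` with respect to `μ`: the
eigenvalues are non-negative and non-increasing, the functions `u k` are orthonormal in `L²(μ)`, and
`f(z,z') = ∑ k, lam k * u k z * u k z'` for all `z, z'`, absolutely and uniformly. Functions with
`lam k = 0` do not enter the expansion and are left unconstrained, so that finite-dimensional
`L²(μ)` is included. -/
structure IsMercerExpansion {𝒵 : Type*} [MeasurableSpace 𝒵] (μ : Measure 𝒵) (f : 𝒵 → 𝒵 → ℝ)
    (lam : ℕ → ℝ) (u : ℕ → 𝒵 → ℝ) : Prop where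
  nonneg : ∀ k, 0 ≤ lam k
  antitone : Antitone lam
  memLp : ∀ k, 0 < lam k → MemLp (u k) 2 μ
  orthonormal : ∀ k l, 0 < lam k → 0 < lam l →
    ∫ z, u k z * u l z ∂μ = if k = l then 1 else 0
  hasSum : ∀ z z', HasSum (fun k => lam k * u k z * u k z') (f z z')
  uniform : TendstoUniformly
    (fun (N : ℕ) (a : 𝒵 × 𝒵) => ∑ k ∈ Finset.range N, lam k * u k a.1 * u k a.2)
    (fun a => f a.1 a.2) Filter.atTop

/-- Exactly the first `r` eigenvalues are positive, and the others vanish. -/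
def HasRank (lam : ℕ → ℝ) (r : ℕ) : Prop :=
  (∀ k, k < r → 0 < lam k) ∧ ∀ k, r ≤ k → lam k = 0

/-- The rank-`r` feature map `φ(z) = (lam k ^ (1/2) * u k z)_{k < r}`. -/
def featureMap {𝒵 : Type*} (lam : ℕ → ℝ) (u : ℕ → 𝒵 → ℝ) (r : ℕ) (z : 𝒵) :
    EuclideanSpace ℝ (Fin r) :=
  WithLp.toLp 2 fun k => √(lam k) * u k z

theorem isHermitian_transpose_mul_self {n p : ℕ} (Y : Matrix (Fin n) (Fin p) ℝ) :
    (Yᵀ * Y).IsHermitian := by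
  rw [← Matrix.conjTranspose_eq_transpose_of_trivial]
  exact Matrix.isHermitian_conjTranspose_mul_self Y

/-- The eigenvalues of `Yᵀ Y`, with multiplicity and in non-increasing order. -/
def sortedEigenvalues {n p : ℕ} (Y : Matrix (Fin n) (Fin p) ℝ) (k : Fin p) : ℝ :=
  (isHermitian_transpose_mul_self Y).eigenvalues₀ (Fin.cast (Fintype.card_fin p).symm k)

/-- The columns of `V` are orthonormal eigenvectors of `Yᵀ Y` associated, in some order, with its
`r` largest eigenvalues (counted with multiplicity). -/
def IsTopEigenvectors {n p r : ℕ} (hrp : r ≤ p) (Y : Matrix (Fin n) (Fin p) ℝ)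
    (V : Matrix (Fin p) (Fin r) ℝ) : Prop :=
  Vᵀ * V = 1 ∧ ∃ τ : Equiv.Perm (Fin r), ∀ k,
    (Yᵀ * Y) *ᵥ V.col k = sortedEigenvalues Y (Fin.castLE hrp (τ k)) • V.col k

/-- The `i`-th PC score: the `i`-th row of `Y V`. -/
def pcScore {n p r : ℕ} (Y : Matrix (Fin n) (Fin p) ℝ) (V : Matrix (Fin p) (Fin r) ℝ)
    (i : Fin n) : Fin r → ℝ :=
  (Y * V) i

end LatentMetricSpace

end

/-!
The norms of the rows of a matrix are at most its Frobenius norm, so it suffices to find a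
rotation of the normalized scores `A = p^(-1/2) Y V` which is close, in Frobenius norm, to the
matrix `B` with rows `φ(Z i)`.

Deterministic part. Since `f(z, z') = ⟨φ(z), φ(z')⟩`, one has `p⁻¹ Y Yᵀ = B Bᵀ + σ² 1 + Δ`, where
`Δ` is centred given the latent variables (`dataMatrix_mul_transpose`). The columns of `V` are top
eigenvectors, so the part of `p⁻¹ Y Yᵀ` that `A Aᵀ` misses has operator norm at most `σ² + ‖Δ‖`,
by a min-max argument (`residual_sq_le`), and `A Aᵀ - B Bᵀ` has operator norm at most `η = 2 (σ² +
‖Δ‖)` (`bilinear_sq_le`). If `Bᵀ B ≥ m` and `η < m`, the polar factor of `Aᵀ B` is a rotation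
which makes the squared Frobenius distance at most `4 r η² / m`
(`exists_orthogonal_frobenius_sq_le`).

Probabilistic part. For frozen latent positions each entry of `Δ` is a mean of `p` independent
centred variables, so its `2q`-th moment is of order `p^(-q)` by a Marcinkiewicz–Zygmund
inequality (`integral_abs_sum_rpow_le`). The latent variables are independent of the rest, so the
bound survives their randomness, and Markov's inequality makes `‖Δ‖²` of order `n² / (p δ^(1/q))`
in Frobenius norm (`IsModel.measure_deviation_le`). The entries of the Gram matrix of the
eigenfunctions are empirical means of bounded functions, and Hoeffding's inequality gives `Bᵀ B ≥
n λᵣ / 2` with failure probability at most `r² exp (-n / (8 b⁴))`, where `b = sup f / λᵣ ≥ r`,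
with the supremum over the diagonal (`measure_gram_lower_fail_le`). With `m = n λᵣ / 2` the two
conditions on `n` and `p / n` make `4 r η² / m` at most `ε² / 4` (`exists_orthogonal_le_of_good`).

Choice of the rotation. It has to be measurable and may not depend on `δ` and `ε`. It is taken as
a near-minimizer of the Frobenius distance over a countable dense set of orthogonal matrices, with
slack `p^(-1/2) / 2` (`exists_measurable_near_minimizer`); the condition on `p / n` implies `ε ≥
p^(-1/2)`, so the slack is at most `ε / 2`.
-/

noncomputable section

namespace LatentMetricSpace

/-! ### Top eigenvectors of a Gram matrix -/

section LinearAlgebra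

variable {ι κ : Type*} [Fintype ι] [Fintype κ]

theorem dotProduct_sq_le (x y : ι → ℝ) : (x ⬝ᵥ y) ^ 2 ≤ (x ⬝ᵥ x) * (y ⬝ᵥ y) := by
  simpa [dotProduct, sq] using Finset.sum_mul_sq_le_sq_mul_sq Finset.univ x y

theorem dotProduct_self_nonneg' (x : ι → ℝ) : 0 ≤ x ⬝ᵥ x :=
  Finset.sum_nonneg fun _ _ => mul_self_nonneg _

theorem dotProduct_self_pos' {x : ι → ℝ} (hx : x ≠ 0) : 0 < x ⬝ᵥ x :=
  (dotProduct_self_nonneg' x).lt_of_ne fun h => hx (dotProduct_self_eq_zero.1 h.symm)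

theorem dotProduct_mulVec_comm (A : Matrix ι κ ℝ) (x : ι → ℝ) (y : κ → ℝ) :
    x ⬝ᵥ A *ᵥ y = Aᵀ *ᵥ x ⬝ᵥ y := by
  rw [Matrix.dotProduct_mulVec, Matrix.mulVec_transpose]

/-- Parseval's identity and the diagonal form of a symmetric matrix in an orthonormal eigenbasis. -/
theorem dotProduct_eigenvectorBasis_sum [DecidableEq ι] {S : Matrix ι ι ℝ} (hS : S.IsHermitian)
    (y : ι → ℝ) :
    y ⬝ᵥ y = ∑ i, ((hS.eigenvectorBasis i).ofLp ⬝ᵥ y) ^ 2 ∧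
    y ⬝ᵥ S *ᵥ y = ∑ i, hS.eigenvalues i * ((hS.eigenvectorBasis i).ofLp ⬝ᵥ y) ^ 2 := by
  have hin : ∀ a b : EuclideanSpace ℝ ι, inner ℝ a b = a.ofLp ⬝ᵥ b.ofLp := by
    intro a b
    simp [PiLp.inner_apply, dotProduct, mul_comm]
  have key : ∀ w : ι → ℝ, y ⬝ᵥ w = ∑ i, ((hS.eigenvectorBasis i).ofLp ⬝ᵥ y) *
      ((hS.eigenvectorBasis i).ofLp ⬝ᵥ w) := by
    intro w
    have := hS.eigenvectorBasis.sum_inner_mul_inner (WithLp.toLp 2 y) (WithLp.toLp 2 w)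
    rw [hin] at this
    rw [show y ⬝ᵥ w = (WithLp.toLp 2 y).ofLp ⬝ᵥ (WithLp.toLp 2 w).ofLp from rfl, ← this]
    refine Finset.sum_congr rfl fun i _ => ?_
    rw [hin, hin, dotProduct_comm]
  constructor
  · rw [key y]; simp [sq]
  · rw [key]
    refine Finset.sum_congr rfl fun i _ => ?_
    have hT : Sᵀ = S := by
      rw [← Matrix.conjTranspose_eq_transpose_of_trivial]; exact hS
    rw [dotProduct_mulVec_comm, hT, hS.mulVec_eigenvectorBasis]
    simp; ring

/-- A linear map out of `ℝ × ℝʳ` into `ℝʳ` has a nontrivial kernel. In the min-max arguments below,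
`(t, c)` are the coordinates of a vector in an `(r + 1)`-dimensional space, on which `r` linear
conditions are imposed. -/
theorem exists_ne_zero_of_linearMap_succ {r : ℕ}
    (L : (ℝ × (Fin r → ℝ)) →ₗ[ℝ] (Fin r → ℝ)) : ∃ a, a ≠ 0 ∧ L a = 0 := by
  have h : LinearMap.ker L ≠ ⊥ := by
    apply LinearMap.ker_ne_bot_of_finrank_lt
    simp
  obtain ⟨a, ha, h0⟩ := (Submodule.ne_bot_iff _).1 h
  exact ⟨a, h0, ha⟩

/-- If the columns of `V` are top eigenvectors of `Yᵀ Y`, then each of their eigenvalues is at least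
the Rayleigh quotient of `Yᵀ Y` at every vector orthogonal to the columns. Otherwise a quotient `ρ`
exceeds the eigenvalue of some column, and the span of that vector and of the columns with
eigenvalue at least `ρ` has larger dimension than the sum of the eigenspaces of eigenvalue at least
`ρ`; a nonzero vector of the former orthogonal to the latter has Rayleigh quotient both at least
and less than `ρ`. -/
theorem IsTopEigenvectors.exists_eigenvalues {n p r : ℕ} {hrp : r ≤ p}
    {Y : Matrix (Fin n) (Fin p) ℝ} {V : Matrix (Fin p) (Fin r) ℝ}
    (h : IsTopEigenvectors hrp Y V) :
    ∃ Λ : Fin r → ℝ, (Yᵀ * Y) * V = V * Matrix.diagonal Λ ∧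
      ∀ x, Vᵀ *ᵥ x = 0 → ∀ k, (Y *ᵥ x) ⬝ᵥ (Y *ᵥ x) ≤ Λ k * (x ⬝ᵥ x) := by
  obtain ⟨hV, τ, hτ⟩ := h
  set Λ : Fin r → ℝ := fun k => sortedEigenvalues Y (Fin.castLE hrp (τ k)) with hΛ
  have hYV : (Yᵀ * Y) * V = V * Matrix.diagonal Λ := by
    ext a k
    have := congrFun (hτ k) a
    simp only [Matrix.mulVec, Matrix.col, dotProduct, Pi.smul_apply, smul_eq_mul] at this
    rw [Matrix.mul_apply, Matrix.mul_diagonal]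
    simpa [mul_comm] using this
  refine ⟨Λ, hYV, fun x hx k₀ => ?_⟩
  by_contra! hlt
  set S := Yᵀ * Y with hSdef
  have hS := isHermitian_transpose_mul_self Y
  have hST : Sᵀ = S := by simp [hSdef]
  have hx0 : 0 < x ⬝ᵥ x := by
    refine dotProduct_self_pos' fun h0 => ?_
    subst h0
    simp at hlt
  set ρ := (Y *ᵥ x) ⬝ᵥ (Y *ᵥ x) / (x ⬝ᵥ x) with hρ
  have hρx : (Y *ᵥ x) ⬝ᵥ (Y *ᵥ x) = ρ * (x ⬝ᵥ x) := by rw [hρ]; field_simp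
  have hk₀ : Λ k₀ < ρ := by rw [hρ, lt_div_iff₀ hx0]; exact hlt
  have hxS : x ⬝ᵥ S *ᵥ x = ρ * (x ⬝ᵥ x) := by
    rw [← hρx, hSdef, ← Matrix.mulVec_mulVec, dotProduct_mulVec_comm, Matrix.transpose_transpose]
  -- the sorted eigenbasis
  let g : Fin p ≃ Fin p := (finCongr (Fintype.card_fin p).symm).trans
    (Fintype.equivOfCardEq (Fintype.card_fin _))
  let e : Fin p → Fin p → ℝ := fun k => (hS.eigenvectorBasis (g k)).ofLp
  have hsorted : ∀ k, hS.eigenvalues (g k) = sortedEigenvalues Y k := by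
    intro k
    simp [Matrix.IsHermitian.eigenvalues, sortedEigenvalues, g]
  have hanti : Antitone (sortedEigenvalues Y) := by
    intro a b hab
    exact hS.eigenvalues₀_antitone (show Fin.cast _ a ≤ Fin.cast _ b from hab)
  have hsum : ∀ y, y ⬝ᵥ y = ∑ k, (e k ⬝ᵥ y) ^ 2 ∧
      y ⬝ᵥ S *ᵥ y = ∑ k, sortedEigenvalues Y k * (e k ⬝ᵥ y) ^ 2 := by
    intro y
    obtain ⟨h1, h2⟩ := dotProduct_eigenvectorBasis_sum hS y
    rw [← g.sum_comp] at h1 h2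
    refine ⟨h1, h2.trans ?_⟩
    simp_rw [hsorted]
    rfl
  -- the `k`-th condition removes the `k`-th column if its eigenvalue is below `ρ`, and imposes
  -- orthogonality to the `k`-th eigenvector otherwise
  let L : (ℝ × (Fin r → ℝ)) →ₗ[ℝ] (Fin r → ℝ) :=
    { toFun := fun a k => if ρ ≤ Λ k then e (Fin.castLE hrp (τ k)) ⬝ᵥ (a.1 • x + V *ᵥ a.2)
        else a.2 k
      map_add' := by
        intro a b
        ext k
        by_cases hk : ρ ≤ Λ k
        · simp [hk, Matrix.mulVec_add, add_mul]; ring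
        · simp [hk]
      map_smul' := by
        intro c a
        ext k
        by_cases hk : ρ ≤ Λ k
        · simp [hk, Matrix.mulVec_smul]; ring
        · simp [hk] }
  obtain ⟨⟨t, c⟩, hne, hL⟩ := exists_ne_zero_of_linearMap_succ L
  have hL' : ∀ k, if ρ ≤ Λ k then e (Fin.castLE hrp (τ k)) ⬝ᵥ (t • x + V *ᵥ c) = 0
      else c k = 0 := by
    intro k
    have := congrFun hL k
    by_cases hk : ρ ≤ Λ k
    · simpa [L, hk] using this
    · simpa [L, hk] using this
  set y := t • x + V *ᵥ c with hy
  have hVVc : ∀ w : Fin r → ℝ, (V *ᵥ c) ⬝ᵥ (V *ᵥ w) = c ⬝ᵥ w := by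
    intro w
    rw [dotProduct_mulVec_comm, Matrix.mulVec_mulVec, hV, Matrix.one_mulVec]
  have hxV : ∀ w : Fin r → ℝ, x ⬝ᵥ V *ᵥ w = 0 := by
    intro w
    rw [dotProduct_mulVec_comm, hx, zero_dotProduct]
  have hSV : S *ᵥ (V *ᵥ c) = V *ᵥ (fun k => Λ k * c k) := by
    rw [Matrix.mulVec_mulVec, hYV, ← Matrix.mulVec_mulVec]
    congr 1
    ext k
    simp [Matrix.mulVec_diagonal]
  have hyy : y ⬝ᵥ y = t ^ 2 * (x ⬝ᵥ x) + c ⬝ᵥ c := by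
    rw [hy]
    simp only [add_dotProduct, dotProduct_add, smul_dotProduct, dotProduct_smul, hxV, hVVc,
      dotProduct_comm (V *ᵥ c) x, smul_eq_mul]
    ring
  have hxSV : (V *ᵥ c) ⬝ᵥ S *ᵥ x = 0 := by
    rw [dotProduct_mulVec_comm, hST, hSV, dotProduct_comm, hxV]
  have hySy : y ⬝ᵥ S *ᵥ y = t ^ 2 * (ρ * (x ⬝ᵥ x)) + ∑ k, Λ k * c k ^ 2 := by
    have hcc : c ⬝ᵥ (fun k => Λ k * c k) = ∑ k, Λ k * c k ^ 2 := by
      simp only [dotProduct]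
      exact Finset.sum_congr rfl fun k _ => by ring
    rw [hy, Matrix.mulVec_add, Matrix.mulVec_smul, hSV]
    simp only [add_dotProduct, dotProduct_add, smul_dotProduct, dotProduct_smul, hxV, hVVc, hxSV,
      hxS, hcc, smul_eq_mul]
    ring
  have hypos : 0 < y ⬝ᵥ y := by
    rw [hyy]
    have h1 := dotProduct_self_nonneg' c
    by_cases ht : t = 0
    · have hc : c ≠ 0 := by
        rintro rfl
        exact hne (by simp [ht])
      have := dotProduct_self_pos' hc
      positivity
    · positivity
  have hge : ρ * (y ⬝ᵥ y) ≤ y ⬝ᵥ S *ᵥ y := by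
    rw [hyy, hySy, mul_add]
    have : ρ * (c ⬝ᵥ c) ≤ ∑ k, Λ k * c k ^ 2 := by
      rw [dotProduct, Finset.mul_sum]
      refine Finset.sum_le_sum fun k _ => ?_
      have := hL' k
      by_cases hk : ρ ≤ Λ k
      · nlinarith [sq_nonneg (c k)]
      · simp only [hk, if_false] at this
        simp [this]
    nlinarith
  have hlt' : y ⬝ᵥ S *ᵥ y < ρ * (y ⬝ᵥ y) := by
    have hcoef : ∀ k, sortedEigenvalues Y k < ρ ∨ e k ⬝ᵥ y = 0 := by
      intro k
      by_cases hkr : (k : ℕ) < r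
      · have h1 := hL' (τ.symm ⟨k, hkr⟩)
        have h2 : Fin.castLE hrp (τ (τ.symm ⟨k, hkr⟩)) = k := by ext; simp
        simp only [hΛ, h2] at h1
        by_cases hk : ρ ≤ sortedEigenvalues Y k
        · right; simpa [hk] using h1
        · left; exact not_le.1 hk
      · left
        refine lt_of_le_of_lt (hanti ?_) hk₀
        simp only [Fin.le_def, Fin.val_castLE]
        omega
    rw [(hsum y).1, (hsum y).2, Finset.mul_sum]
    have hex : ∃ k, e k ⬝ᵥ y ≠ 0 := by
      by_contra! hall
      rw [(hsum y).1] at hypos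
      simp [hall] at hypos
    obtain ⟨k, hk⟩ := hex
    refine Finset.sum_lt_sum (fun k _ => ?_) ⟨k, Finset.mem_univ _, ?_⟩
    · rcases hcoef k with h | h
      · exact mul_le_mul_of_nonneg_right h.le (sq_nonneg _)
      · simp [h]
    · rcases hcoef k with h | h
      · exact mul_lt_mul_of_pos_right h (by positivity)
      · exact absurd h hk
  exact absurd hlt' (not_lt.2 hge)

end LinearAlgebra

/-! ### Perturbation bounds and orthogonal alignment -/

section Perturbation

variable {n p r : ℕ}

/-- Weyl's inequality for the residual of the top `r` eigenvectors: if `Y Yᵀ` is a matrix of rank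
at most `r` plus `s • 1 + Δ`, then `Yᵀ Y` is at most `s + d` on the orthogonal complement of the
columns of `V`. For `ν` the Rayleigh quotient at `x`, the quadratic form of `Y Yᵀ` is at least `ν`
on the span of `Y x` and the columns of `Y V`, of dimension `r + 1`, and this span contains a
nonzero vector of the kernel of `Bᵀ`, where the form is at most `s + d`. -/
theorem residual_sq_le {Y : Matrix (Fin n) (Fin p) ℝ} {V : Matrix (Fin p) (Fin r) ℝ}
    {B : Matrix (Fin n) (Fin r) ℝ} {Δ : Matrix (Fin n) (Fin n) ℝ} {Λ : Fin r → ℝ} {s d : ℝ}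
    (hV : Vᵀ * V = 1) (hYV : (Yᵀ * Y) * V = V * Matrix.diagonal Λ)
    (hdom : ∀ x, Vᵀ *ᵥ x = 0 → ∀ k, (Y *ᵥ x) ⬝ᵥ (Y *ᵥ x) ≤ Λ k * (x ⬝ᵥ x))
    (hdec : Y * Yᵀ = B * Bᵀ + s • 1 + Δ) (hs : 0 ≤ s) (hd : 0 ≤ d)
    (hΔ : ∀ x, x ⬝ᵥ Δ *ᵥ x ≤ d * (x ⬝ᵥ x)) {x : Fin p → ℝ} (hx : Vᵀ *ᵥ x = 0) :
    (Y *ᵥ x) ⬝ᵥ (Y *ᵥ x) ≤ (s + d) * (x ⬝ᵥ x) := by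
  set w := Y *ᵥ x with hw
  by_cases hw0 : w = 0
  · have := dotProduct_self_nonneg' x
    rw [hw0, zero_dotProduct]; positivity
  have hww := dotProduct_self_pos' hw0
  have hx0 : 0 < x ⬝ᵥ x := by
    refine dotProduct_self_pos' fun h0 => hw0 ?_
    rw [hw, h0, Matrix.mulVec_zero]
  set ν := w ⬝ᵥ w / (x ⬝ᵥ x) with hν
  have hνx : w ⬝ᵥ w = ν * (x ⬝ᵥ x) := by rw [hν]; field_simp
  have hνpos : 0 < ν := by positivity
  have hνΛ : ∀ k, ν ≤ Λ k := fun k => by rw [hν, div_le_iff₀ hx0]; exact hdom x hx k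
  set A := Y * V with hA
  have hAA : Aᵀ * A = Matrix.diagonal Λ := by
    rw [hA, Matrix.transpose_mul, Matrix.mul_assoc, ← Matrix.mul_assoc Yᵀ, hYV,
      ← Matrix.mul_assoc, hV, Matrix.one_mul]
  have hAw : Aᵀ *ᵥ w = 0 := by
    have h1 : Aᵀ * Y = Matrix.diagonal Λ * Vᵀ := by
      have := congrArg Matrix.transpose hYV
      rw [hA, Matrix.transpose_mul, Matrix.mul_assoc]
      simpa [Matrix.transpose_mul] using this
    rw [hw, Matrix.mulVec_mulVec, h1, ← Matrix.mulVec_mulVec, hx, Matrix.mulVec_zero]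
  let L : (ℝ × (Fin r → ℝ)) →ₗ[ℝ] (Fin r → ℝ) :=
    Bᵀ.mulVecLin ∘ₗ (LinearMap.coprod (LinearMap.toSpanSingleton ℝ _ w) A.mulVecLin)
  obtain ⟨⟨t, c⟩, hne, hL⟩ := exists_ne_zero_of_linearMap_succ L
  set y := t • w + A *ᵥ c with hy
  have hBy : Bᵀ *ᵥ y = 0 := hL
  have hyy : y ⬝ᵥ y = t ^ 2 * (w ⬝ᵥ w) + ∑ k, Λ k * c k ^ 2 := by
    have h1 : ∀ c', w ⬝ᵥ A *ᵥ c' = 0 := fun c' => by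
      rw [dotProduct_mulVec_comm, hAw, zero_dotProduct]
    have h2 : (A *ᵥ c) ⬝ᵥ (A *ᵥ c) = ∑ k, Λ k * c k ^ 2 := by
      rw [dotProduct_mulVec_comm, Matrix.mulVec_mulVec, hAA]
      simp only [dotProduct, Matrix.mulVec_diagonal]
      exact Finset.sum_congr rfl fun k _ => by ring
    rw [hy]
    simp only [add_dotProduct, dotProduct_add, smul_dotProduct, dotProduct_smul, h1, h2,
      dotProduct_comm (A *ᵥ c) w, smul_eq_mul]
    ring
  have hyS : y ⬝ᵥ (Y * Yᵀ) *ᵥ y = t ^ 2 * ((Yᵀ *ᵥ w) ⬝ᵥ (Yᵀ *ᵥ w)) + ∑ k, Λ k ^ 2 * c k ^ 2 := by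
    have h3 : Yᵀ *ᵥ y = t • (Yᵀ *ᵥ w) + V *ᵥ (fun k => Λ k * c k) := by
      rw [hy, Matrix.mulVec_add, Matrix.mulVec_smul, Matrix.mulVec_mulVec c, hA, ← Matrix.mul_assoc,
        hYV, ← Matrix.mulVec_mulVec]
      congr 2
      ext k
      simp [Matrix.mulVec_diagonal]
    have h4 : ∀ c', (Yᵀ *ᵥ w) ⬝ᵥ (V *ᵥ c') = 0 := fun c' => by
      rw [dotProduct_mulVec_comm, Matrix.mulVec_mulVec, ← Matrix.transpose_mul, hAw,
        zero_dotProduct]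
    have h5 : ∀ c', (V *ᵥ c') ⬝ᵥ (V *ᵥ c') = c' ⬝ᵥ c' := fun c' => by
      rw [dotProduct_mulVec_comm, Matrix.mulVec_mulVec, hV, Matrix.one_mulVec]
    have h6 : ((fun k => Λ k * c k) ⬝ᵥ (fun k => Λ k * c k)) = ∑ k, Λ k ^ 2 * c k ^ 2 := by
      simp only [dotProduct]
      exact Finset.sum_congr rfl fun k _ => by ring
    rw [← Matrix.mulVec_mulVec, dotProduct_mulVec_comm, h3]
    simp only [add_dotProduct, dotProduct_add, smul_dotProduct, dotProduct_smul, h4, h5, h6,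
      dotProduct_comm (V *ᵥ _) (Yᵀ *ᵥ w), smul_eq_mul]
    ring
  have hypos : 0 < y ⬝ᵥ y := by
    have hΛpos : ∀ k, 0 < Λ k := fun k => hνpos.trans_le (hνΛ k)
    rw [hyy]
    have h1 : 0 ≤ ∑ k, Λ k * c k ^ 2 :=
      Finset.sum_nonneg fun k _ => mul_nonneg (hΛpos k).le (sq_nonneg _)
    by_cases ht : t = 0
    · obtain ⟨k, hk⟩ : ∃ k, c k ≠ 0 := by
        by_contra! hc
        exact hne (by simp [ht, funext_iff, hc])
      have : 0 < ∑ k, Λ k * c k ^ 2 := by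
        refine Finset.sum_pos' (fun k _ => mul_nonneg (hΛpos k).le (sq_nonneg _))
          ⟨k, Finset.mem_univ _, mul_pos (hΛpos k) (by positivity)⟩
      positivity
    · positivity
  have hge : ν * (y ⬝ᵥ y) ≤ y ⬝ᵥ (Y * Yᵀ) *ᵥ y := by
    rw [hyy, hyS, mul_add, Finset.mul_sum]
    have hw2 : ν * (w ⬝ᵥ w) ≤ (Yᵀ *ᵥ w) ⬝ᵥ (Yᵀ *ᵥ w) := by
      -- Cauchy–Schwarz: `‖w‖² = ⟨x, Yᵀ w⟩`
      have h7 : w ⬝ᵥ w = x ⬝ᵥ Yᵀ *ᵥ w := by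
        rw [dotProduct_mulVec_comm _ x, Matrix.transpose_transpose]
      have h8 := dotProduct_sq_le x (Yᵀ *ᵥ w)
      rw [← h7] at h8
      rw [hν, div_mul_eq_mul_div, div_le_iff₀ hx0]
      nlinarith
    have : ∑ k, ν * (Λ k * c k ^ 2) ≤ ∑ k, Λ k ^ 2 * c k ^ 2 := by
      refine Finset.sum_le_sum fun k _ => ?_
      have h9 := mul_le_mul_of_nonneg_right (hνΛ k) (mul_nonneg (hνpos.le.trans (hνΛ k))
        (sq_nonneg (c k)))
      nlinarith
    nlinarith [mul_le_mul_of_nonneg_left hw2 (sq_nonneg t)]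
  have hle : y ⬝ᵥ (Y * Yᵀ) *ᵥ y ≤ (s + d) * (y ⬝ᵥ y) := by
    rw [hdec, Matrix.add_mulVec, Matrix.add_mulVec, ← Matrix.mulVec_mulVec, hBy,
      Matrix.mulVec_zero, zero_add, Matrix.smul_mulVec, Matrix.one_mulVec, dotProduct_add,
      dotProduct_smul, smul_eq_mul, add_mul]
    linarith [hΔ y]
  have : ν ≤ s + d := le_of_mul_le_mul_right (hge.trans hle) hypos
  rw [hνx]
  exact mul_le_mul_of_nonneg_right this hx0.le

/-- The operator norm of `(Y V) (Y V)ᵀ - B Bᵀ` is at most `2 (s + d)`, stated for bilinear forms: it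
equals `s • 1 + Δ` minus the residual `Y (1 - V Vᵀ) Yᵀ`, which `residual_sq_le` bounds. -/
theorem bilinear_sq_le {Y : Matrix (Fin n) (Fin p) ℝ} {V : Matrix (Fin p) (Fin r) ℝ}
    {B : Matrix (Fin n) (Fin r) ℝ} {Δ : Matrix (Fin n) (Fin n) ℝ} {Λ : Fin r → ℝ} {s d : ℝ}
    (hV : Vᵀ * V = 1) (hYV : (Yᵀ * Y) * V = V * Matrix.diagonal Λ)
    (hdom : ∀ x, Vᵀ *ᵥ x = 0 → ∀ k, (Y *ᵥ x) ⬝ᵥ (Y *ᵥ x) ≤ Λ k * (x ⬝ᵥ x))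
    (hdec : Y * Yᵀ = B * Bᵀ + s • 1 + Δ) (hs : 0 ≤ s) (hd : 0 ≤ d)
    (hΔ : ∀ x y, (x ⬝ᵥ Δ *ᵥ y) ^ 2 ≤ d ^ 2 * ((x ⬝ᵥ x) * (y ⬝ᵥ y))) (x y : Fin n → ℝ) :
    (x ⬝ᵥ ((Y * V) * (Y * V)ᵀ - B * Bᵀ) *ᵥ y) ^ 2 ≤
      (2 * (s + d)) ^ 2 * ((x ⬝ᵥ x) * (y ⬝ᵥ y)) := by
  have hΔ1 : ∀ x, x ⬝ᵥ Δ *ᵥ x ≤ d * (x ⬝ᵥ x) := by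
    intro x
    have := hΔ x x
    have h0 := dotProduct_self_nonneg' x
    exact le_of_sq_le_sq (by nlinarith) (by positivity)
  -- `P = 1 - V Vᵀ` is the orthogonal projection off the range of `V`
  set P : Matrix (Fin p) (Fin p) ℝ := 1 - V * Vᵀ with hP
  have hPT : Pᵀ = P := by simp [hP]
  have hVP : Vᵀ * P = 0 := by
    rw [hP, Matrix.mul_sub, ← Matrix.mul_assoc, hV]; simp
  have hPP : P * P = P := by
    nth_rewrite 1 [hP]
    rw [Matrix.sub_mul, Matrix.mul_assoc, hVP]; simp
  have hproj : ∀ x, (P *ᵥ (Yᵀ *ᵥ x)) ⬝ᵥ (P *ᵥ (Yᵀ *ᵥ x)) ≤ (s + d) * (x ⬝ᵥ x) := by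
    intro x
    set z := P *ᵥ (Yᵀ *ᵥ x) with hz
    have hVz : Vᵀ *ᵥ z = 0 := by rw [hz, Matrix.mulVec_mulVec, hVP, Matrix.zero_mulVec]
    have h1 := residual_sq_le hV hYV hdom hdec hs hd hΔ1 hVz
    have h2 : z ⬝ᵥ z = x ⬝ᵥ Y *ᵥ z := by
      have hPz : P *ᵥ z = z := by rw [hz, Matrix.mulVec_mulVec, hPP]
      calc z ⬝ᵥ z = z ⬝ᵥ P *ᵥ (Yᵀ *ᵥ x) := rfl
        _ = x ⬝ᵥ Y *ᵥ z := by
          rw [dotProduct_mulVec_comm, hPT, hPz, dotProduct_mulVec_comm, dotProduct_comm,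
            Matrix.transpose_transpose]
    have h3 := dotProduct_sq_le x (Y *ᵥ z)
    rw [← h2] at h3
    have hz0 := dotProduct_self_nonneg' z
    have hx0 := dotProduct_self_nonneg' x
    rcases hz0.eq_or_lt with h | h
    · rw [← h]; positivity
    · refine le_of_mul_le_mul_right ?_ h
      nlinarith [mul_le_mul_of_nonneg_left h1 hx0]
  have hE : (Y * V) * (Y * V)ᵀ - B * Bᵀ = s • 1 + Δ - Y * P * Yᵀ := by
    rw [hP, Matrix.mul_sub, Matrix.sub_mul, Matrix.mul_one, hdec, Matrix.transpose_mul]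
    simp only [Matrix.mul_assoc]
    abel
  have hN : x ⬝ᵥ (Y * P * Yᵀ) *ᵥ y = (P *ᵥ (Yᵀ *ᵥ x)) ⬝ᵥ (P *ᵥ (Yᵀ *ᵥ y)) := by
    rw [dotProduct_mulVec_comm P (P *ᵥ _), hPT, Matrix.mulVec_mulVec _ P P, hPP,
      Matrix.mul_assoc, ← Matrix.mulVec_mulVec, ← Matrix.mulVec_mulVec, dotProduct_mulVec_comm,
      dotProduct_mulVec_comm, hPT]
  have hexp : x ⬝ᵥ ((Y * V) * (Y * V)ᵀ - B * Bᵀ) *ᵥ y =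
      s * (x ⬝ᵥ y) + x ⬝ᵥ Δ *ᵥ y - (P *ᵥ (Yᵀ *ᵥ x)) ⬝ᵥ (P *ᵥ (Yᵀ *ᵥ y)) := by
    rw [hE, Matrix.sub_mulVec, Matrix.add_mulVec, Matrix.smul_mulVec, Matrix.one_mulVec,
      dotProduct_sub, dotProduct_add, dotProduct_smul, smul_eq_mul, hN]
  have hx0 := dotProduct_self_nonneg' x
  have hy0 := dotProduct_self_nonneg' y
  set G := √((x ⬝ᵥ x) * (y ⬝ᵥ y)) with hG
  have hG2 : G ^ 2 = (x ⬝ᵥ x) * (y ⬝ᵥ y) := Real.sq_sqrt (by positivity)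
  have hG0 : 0 ≤ G := Real.sqrt_nonneg _
  have b1 : |x ⬝ᵥ y| ≤ G := abs_le_of_sq_le_sq (by rw [hG2]; exact dotProduct_sq_le x y) hG0
  have b2 : |x ⬝ᵥ Δ *ᵥ y| ≤ d * G :=
    abs_le_of_sq_le_sq (by rw [mul_pow, hG2]; exact hΔ x y) (by positivity)
  have b3 : |(P *ᵥ (Yᵀ *ᵥ x)) ⬝ᵥ (P *ᵥ (Yᵀ *ᵥ y))| ≤ (s + d) * G := by
    refine abs_le_of_sq_le_sq ((dotProduct_sq_le _ _).trans ?_) (by positivity)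
    calc _ ≤ ((s + d) * (x ⬝ᵥ x)) * ((s + d) * (y ⬝ᵥ y)) :=
          mul_le_mul (hproj x) (hproj y) (dotProduct_self_nonneg' _) (by positivity)
      _ = _ := by rw [mul_pow, hG2]; ring
  rw [hexp, ← hG2, ← mul_pow]
  refine sq_le_sq' ?_ ?_
  · nlinarith [abs_le.1 b1, abs_le.1 b2, abs_le.1 b3, mul_le_mul_of_nonneg_left (abs_le.1 b1).1 hs]
  · nlinarith [abs_le.1 b1, abs_le.1 b2, abs_le.1 b3, mul_le_mul_of_nonneg_left (abs_le.1 b1).2 hs]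

/-- If `Aᵀ B` is symmetric and positive semidefinite, the Frobenius distance of `A` and `B` is
controlled by the operator norm `η` of `A Aᵀ - B Bᵀ` and the least eigenvalue `m` of `Bᵀ B`. With
`D = A - B` and `S = A + B`, the matrix `Dᵀ S` is symmetric and `2 (A Aᵀ - B Bᵀ) = D Sᵀ + S Dᵀ`.
Testing this identity on `D x` and `S x` for an eigenvector `x` of `Dᵀ D` bounds its eigenvalue by
`4 η² / m`, since `‖S x‖² ≥ m`; there are `r` eigenvalues. -/
theorem frobenius_sq_le_of_posSemidef {A B : Matrix (Fin n) (Fin r) ℝ} {m η : ℝ} (hm : 0 < m)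
    (hB : ∀ x, m * (x ⬝ᵥ x) ≤ (B *ᵥ x) ⬝ᵥ (B *ᵥ x))
    (hsymm : Aᵀ * B = Bᵀ * A) (hpos : ∀ x, 0 ≤ x ⬝ᵥ (Aᵀ * B) *ᵥ x)
    (hE : ∀ x y, (x ⬝ᵥ (A * Aᵀ - B * Bᵀ) *ᵥ y) ^ 2 ≤ η ^ 2 * ((x ⬝ᵥ x) * (y ⬝ᵥ y))) :
    ∑ i, ∑ k, (A i k - B i k) ^ 2 ≤ r * (4 * η ^ 2 / m) := by
  set D := A - B with hD
  set S := A + B with hS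
  have hDS : Dᵀ * S = Sᵀ * D := by
    simp only [hD, hS, Matrix.transpose_sub, Matrix.transpose_add, Matrix.sub_mul, Matrix.mul_add,
      Matrix.add_mul, Matrix.mul_sub, hsymm]
    abel
  have hE2 : (2 : ℝ) • (A * Aᵀ - B * Bᵀ) = D * Sᵀ + S * Dᵀ := by
    simp only [hD, hS, Matrix.transpose_sub, Matrix.transpose_add, Matrix.sub_mul, Matrix.mul_add,
      Matrix.add_mul, Matrix.mul_sub, two_smul]
    abel
  have hT : (Dᵀ * D).IsHermitian := isHermitian_transpose_mul_self D
  have htr : ∑ i, ∑ k, (A i k - B i k) ^ 2 = ∑ k, hT.eigenvalues k := by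
    have h1 := hT.trace_eq_sum_eigenvalues
    have h2 : (Dᵀ * D).trace = ∑ i, ∑ k, (A i k - B i k) ^ 2 := by
      rw [Finset.sum_comm]
      simp [Matrix.trace, Matrix.mul_apply, hD, sq]
    rw [← h2, h1]; simp
  rw [htr]
  have hbd : ∀ k, hT.eigenvalues k ≤ 4 * η ^ 2 / m := by
    intro k
    set t := hT.eigenvalues k with ht
    set x := (hT.eigenvectorBasis k).ofLp with hx
    have hx1 : x ⬝ᵥ x = 1 := by
      have h1 := hT.eigenvectorBasis.orthonormal.1 k
      have h2 : ‖hT.eigenvectorBasis k‖ ^ 2 = x ⬝ᵥ x := by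
        rw [EuclideanSpace.norm_sq_eq]; simp [dotProduct, hx, sq]
      rw [← h2, h1]; norm_num
    have hTx : (Dᵀ * D) *ᵥ x = t • x := hT.mulVec_eigenvectorBasis k
    have hDx : (D *ᵥ x) ⬝ᵥ (D *ᵥ x) = t := by
      rw [dotProduct_mulVec_comm, Matrix.mulVec_mulVec, hTx, smul_dotProduct, hx1, smul_eq_mul,
        mul_one]
    have ht0 : 0 ≤ t := hDx ▸ dotProduct_self_nonneg' _
    set g := (S *ᵥ x) ⬝ᵥ (S *ᵥ x) with hg
    have hgm : m ≤ g := by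
      have h1 : g = (A *ᵥ x) ⬝ᵥ (A *ᵥ x) + 2 * (x ⬝ᵥ (Aᵀ * B) *ᵥ x) + (B *ᵥ x) ⬝ᵥ (B *ᵥ x) := by
        have h2 : x ⬝ᵥ (Aᵀ * B) *ᵥ x = (A *ᵥ x) ⬝ᵥ (B *ᵥ x) := by
          rw [← Matrix.mulVec_mulVec, dotProduct_mulVec_comm, Matrix.transpose_transpose]
        rw [hg, hS, Matrix.add_mulVec, h2]
        simp only [add_dotProduct, dotProduct_add, dotProduct_comm (B *ᵥ x) (A *ᵥ x)]
        ring
      have h3 := hB x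
      rw [hx1] at h3
      have := dotProduct_self_nonneg' (A *ᵥ x)
      nlinarith [hpos x]
    have hkey : t * g ≤ 2 * ((D *ᵥ x) ⬝ᵥ (A * Aᵀ - B * Bᵀ) *ᵥ (S *ᵥ x)) := by
      have h1 : 2 * ((D *ᵥ x) ⬝ᵥ (A * Aᵀ - B * Bᵀ) *ᵥ (S *ᵥ x)) =
          (D *ᵥ x) ⬝ᵥ (D * Sᵀ + S * Dᵀ) *ᵥ (S *ᵥ x) := by
        rw [← hE2, Matrix.smul_mulVec, dotProduct_smul, smul_eq_mul]
      have h2 : (D *ᵥ x) ⬝ᵥ (D * Sᵀ) *ᵥ (S *ᵥ x) = t * g := by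
        rw [← Matrix.mulVec_mulVec, dotProduct_mulVec_comm, Matrix.mulVec_mulVec, hTx,
          smul_dotProduct, dotProduct_mulVec_comm, Matrix.transpose_transpose, smul_eq_mul]
      have h3 : (D *ᵥ x) ⬝ᵥ (S * Dᵀ) *ᵥ (S *ᵥ x) =
          ((Sᵀ * D) *ᵥ x) ⬝ᵥ ((Sᵀ * D) *ᵥ x) := by
        rw [← Matrix.mulVec_mulVec, dotProduct_mulVec_comm, Matrix.mulVec_mulVec,
          Matrix.mulVec_mulVec, hDS]
      rw [h1, Matrix.add_mulVec, dotProduct_add, h2, h3]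
      linarith [dotProduct_self_nonneg' ((Sᵀ * D) *ᵥ x)]
    have hb := hE (D *ᵥ x) (S *ᵥ x)
    rw [hDx, ← hg] at hb
    rw [le_div_iff₀ hm]
    rcases ht0.eq_or_lt with h | h
    · rw [← h, zero_mul]; positivity
    have hg0 : 0 < g := hm.trans_le hgm
    have h4 : (t * g) ^ 2 ≤ 4 * (η ^ 2 * (t * g)) := by
      have := pow_le_pow_left₀ (by positivity) hkey 2
      nlinarith
    have h5 : t * g ≤ 4 * η ^ 2 := by
      have h6 : 0 < t * g := by positivity
      nlinarith
    nlinarith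
  calc ∑ k, hT.eigenvalues k ≤ ∑ _k : Fin r, 4 * η ^ 2 / m := Finset.sum_le_sum fun k _ => hbd k
    _ = _ := by simp

/-- Polar decomposition of an injective square matrix `H`: the orthogonal factor is
`H (Hᵀ H)^(-1/2)`. -/
theorem exists_orthogonal_mul_posSemidef {H : Matrix (Fin r) (Fin r) ℝ}
    (hH : ∀ x, H *ᵥ x = 0 → x = 0) :
    ∃ Q ∈ Matrix.orthogonalGroup (Fin r) ℝ, (Qᵀ * H)ᵀ = Qᵀ * H ∧
      ∀ x, 0 ≤ x ⬝ᵥ (Qᵀ * H) *ᵥ x := by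
  have hT : (Hᵀ * H).IsHermitian := isHermitian_transpose_mul_self H
  have hpos : ∀ k, 0 < hT.eigenvalues k := by
    intro k
    set x := (hT.eigenvectorBasis k).ofLp with hx
    have hx0 : x ≠ 0 := by
      intro h
      have h1 := hT.eigenvectorBasis.orthonormal.ne_zero k
      exact h1 (by ext i; simpa using congrFun h i)
    have h1 : (H *ᵥ x) ⬝ᵥ (H *ᵥ x) = hT.eigenvalues k * (x ⬝ᵥ x) := by
      rw [dotProduct_mulVec_comm, Matrix.mulVec_mulVec, hT.mulVec_eigenvectorBasis k,
        smul_dotProduct, smul_eq_mul]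
    have h2 := dotProduct_self_pos' (fun h => hx0 (hH x h))
    rw [h1] at h2
    exact pos_of_mul_pos_left h2 (dotProduct_self_nonneg' x)
  set ev := hT.eigenvalues with hev
  set U : Matrix (Fin r) (Fin r) ℝ :=
    (hT.eigenvectorUnitary : Matrix (Fin r) (Fin r) ℝ) with hU
  have hUU : Uᵀ * U = 1 := by
    have := (Matrix.mem_unitaryGroup_iff' (A := U)).1 (hT.eigenvectorUnitary).2
    rwa [Matrix.star_eq_conjTranspose, Matrix.conjTranspose_eq_transpose_of_trivial] at this
  have hUU' : U * Uᵀ = 1 := mul_eq_one_comm.1 hUU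
  have hspec : Hᵀ * H = U * Matrix.diagonal ev * Uᵀ := by
    have := hT.spectral_theorem
    rw [Unitary.conjStarAlgAut_apply, Matrix.star_eq_conjTranspose,
      Matrix.conjTranspose_eq_transpose_of_trivial] at this
    exact this
  set w : Fin r → ℝ := fun k => (√(ev k))⁻¹
  set W := U * Matrix.diagonal w * Uᵀ with hW
  have hWT : Wᵀ = W := by simp [hW, Matrix.transpose_mul, Matrix.mul_assoc]
  have hWH : W * (Hᵀ * H) = U * Matrix.diagonal (fun k => √(ev k)) * Uᵀ := by
    have : ∀ k, w k * ev k = √(ev k) := by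
      intro k
      have h1 := Real.sqrt_pos.2 (hpos k)
      have h2 := Real.mul_self_sqrt (hpos k).le
      simp only [w]
      field_simp
      linarith
    rw [hspec, hW]
    calc U * Matrix.diagonal w * Uᵀ * (U * Matrix.diagonal ev * Uᵀ)
        = U * Matrix.diagonal w * (Uᵀ * U) * Matrix.diagonal ev * Uᵀ := by
          simp only [Matrix.mul_assoc]
      _ = _ := by
          rw [hUU, Matrix.mul_one, Matrix.mul_assoc U, Matrix.diagonal_mul_diagonal]
          simp only [this]
  refine ⟨H * W, ?_, ?_, ?_⟩
  · rw [Matrix.mem_orthogonalGroup_iff', Matrix.transpose_mul, hWT]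
    have h1 : ∀ k, √(ev k) * w k = 1 := fun k =>
      mul_inv_cancel₀ (Real.sqrt_pos.2 (hpos k)).ne'
    calc W * Hᵀ * (H * W) = W * (Hᵀ * H) * W := by simp only [Matrix.mul_assoc]
      _ = U * Matrix.diagonal (fun k => √(ev k)) * (Uᵀ * U) * Matrix.diagonal w * Uᵀ := by
          rw [hWH, hW]; simp only [Matrix.mul_assoc]
      _ = 1 := by
          rw [hUU, Matrix.mul_one, Matrix.mul_assoc U, Matrix.diagonal_mul_diagonal]
          simp only [h1, Matrix.diagonal_one, Matrix.mul_one, hUU']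
  · rw [Matrix.transpose_mul H, hWT, Matrix.mul_assoc, hWH]
    simp [Matrix.transpose_mul, Matrix.mul_assoc]
  · intro x
    rw [Matrix.transpose_mul, hWT, Matrix.mul_assoc, hWH, ← Matrix.mulVec_mulVec,
      ← Matrix.mulVec_mulVec, dotProduct_mulVec_comm]
    simp only [dotProduct, Matrix.mulVec_diagonal]
    refine Finset.sum_nonneg fun k _ => ?_
    nlinarith [Real.sqrt_nonneg (ev k), mul_nonneg (Real.sqrt_nonneg (ev k))
      (mul_self_nonneg ((Uᵀ *ᵥ x) k))]

/-- Orthogonal Procrustes alignment of `A` to `B`. The rotation is the polar factor of `Aᵀ B`,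
which is invertible because `η < m`. -/
theorem exists_orthogonal_frobenius_sq_le {A B : Matrix (Fin n) (Fin r) ℝ} {m η : ℝ} (hm : 0 < m)
    (hB : ∀ x, m * (x ⬝ᵥ x) ≤ (B *ᵥ x) ⬝ᵥ (B *ᵥ x)) (hη : 0 ≤ η) (hηm : η < m)
    (hE : ∀ x y, (x ⬝ᵥ (A * Aᵀ - B * Bᵀ) *ᵥ y) ^ 2 ≤ η ^ 2 * ((x ⬝ᵥ x) * (y ⬝ᵥ y))) :
    ∃ Q ∈ Matrix.orthogonalGroup (Fin r) ℝ,
      ∑ i, ∑ k, ((A * Qᵀ) i k - B i k) ^ 2 ≤ r * (4 * η ^ 2 / m) := by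
  have hinj : ∀ x, (Aᵀ * B) *ᵥ x = 0 → x = 0 := by
    intro x hx
    by_contra hx0
    have hxp := dotProduct_self_pos' hx0
    set y := B *ᵥ x with hy
    have hyx := hB x
    rw [← hy] at hyx
    have hyp : 0 < y ⬝ᵥ y := lt_of_lt_of_le (by positivity) hyx
    have h1 : y ⬝ᵥ (A * Aᵀ - B * Bᵀ) *ᵥ y = - ((Bᵀ *ᵥ y) ⬝ᵥ (Bᵀ *ᵥ y)) := by
      rw [Matrix.sub_mulVec, ← Matrix.mulVec_mulVec, ← Matrix.mulVec_mulVec, dotProduct_sub]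
      have : Aᵀ *ᵥ y = 0 := by rw [hy, Matrix.mulVec_mulVec, hx]
      rw [this, Matrix.mulVec_zero, dotProduct_zero, dotProduct_mulVec_comm]
      ring
    have h2 := hE y y
    rw [h1] at h2
    have h3 : y ⬝ᵥ y = x ⬝ᵥ Bᵀ *ᵥ y := by
      rw [dotProduct_mulVec_comm _ x, Matrix.transpose_transpose]
    have h4 := dotProduct_sq_le x (Bᵀ *ᵥ y)
    rw [← h3] at h4
    set z := (Bᵀ *ᵥ y) ⬝ᵥ (Bᵀ *ᵥ y) with hz
    have hz0 : 0 ≤ z := dotProduct_self_nonneg' _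
    have h5 : z ≤ η * (y ⬝ᵥ y) := by
      refine le_of_sq_le_sq ?_ (by positivity)
      nlinarith
    have h6 : m * (y ⬝ᵥ y) ≤ z := by
      refine le_of_mul_le_mul_left ?_ hxp
      nlinarith
    nlinarith
  obtain ⟨Q, hQ, hsymm, hpos⟩ := exists_orthogonal_mul_posSemidef hinj
  have hQQ : Q * Qᵀ = 1 := by
    exact (Matrix.mem_orthogonalGroup_iff (A := Q)).1 hQ
  refine ⟨Qᵀ, ?_, ?_⟩
  · rw [Matrix.mem_orthogonalGroup_iff', Matrix.transpose_transpose, hQQ]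
  rw [Matrix.transpose_transpose]
  have hAQ : (A * Q)ᵀ * B = Qᵀ * (Aᵀ * B) := by rw [Matrix.transpose_mul, Matrix.mul_assoc]
  refine frobenius_sq_le_of_posSemidef hm hB ?_ ?_ ?_
  · rw [hAQ, ← hsymm, ← hAQ, Matrix.transpose_mul, Matrix.transpose_transpose]
  · rw [hAQ]; exact hpos
  · have : A * Q * (A * Q)ᵀ = A * Aᵀ := by
      rw [Matrix.transpose_mul, Matrix.mul_assoc, ← Matrix.mul_assoc Q, hQQ, Matrix.one_mul]
    rw [this]; exact hE

end Perturbation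

/-! ### A Marcinkiewicz–Zygmund inequality -/

section Moments

theorem rpow_one_add_sub_one_le {a t : ℝ} (ha : 1 ≤ a) (ht : -1 < t) :
    (1 + t) ^ a - 1 ≤ a * t * (1 + t) ^ (a - 1) := by
  have h1 : 0 < 1 + t := by linarith
  have hu : -1 ≤ -t / (1 + t) := by rw [le_div_iff₀ h1]; linarith
  have hb := one_add_mul_self_le_rpow_one_add hu ha
  have h2 : 1 + -t / (1 + t) = (1 + t)⁻¹ := by field_simp; ring
  rw [h2, Real.inv_rpow h1.le] at hb
  have h3 : 0 < (1 + t) ^ a := Real.rpow_pos_of_pos h1 a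
  have h4 := mul_le_mul_of_nonneg_right hb h3.le
  rw [inv_mul_cancel₀ h3.ne', Real.rpow_sub_one h1.ne'] at *
  have h5 : (1 + a * (-t / (1 + t))) * (1 + t) ^ a =
      (1 + t) ^ a - a * t * ((1 + t) ^ a / (1 + t)) := by field_simp; ring
  linarith

/-- A second-order expansion of `|1 + t| ^ s`. The first-order term keeps its sign, so that it
disappears when a centred variable is substituted for `t`. -/
theorem abs_one_add_rpow_le {s : ℝ} (hs : 2 ≤ s) (t : ℝ) :
    |1 + t| ^ s ≤ 1 + s * t + s ^ 2 * 3 ^ s * (t ^ 2 + |t| ^ s) := by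
  have h3 : (1 : ℝ) ≤ 3 ^ s := Real.one_le_rpow (by norm_num) (by linarith)
  have hts : 0 ≤ |t| ^ s := Real.rpow_nonneg (abs_nonneg _) _
  have hC1 : s ≤ s ^ 2 * 3 ^ s := by nlinarith
  have hC3 : (3 : ℝ) ^ s ≤ s ^ 2 * 3 ^ s :=
    le_mul_of_one_le_left (by linarith) (by nlinarith)
  have hC0 : 0 ≤ s ^ 2 * (3 : ℝ) ^ s := by positivity
  rcases le_or_gt |t| (1 / 2) with h | h
  · have ht := abs_le.1 h
    rw [abs_of_pos (by linarith : 0 < 1 + t)]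
    have h1 := rpow_one_add_sub_one_le (by linarith : 1 ≤ s) (by linarith : -1 < t)
    have key : t * ((1 + t) ^ (s - 1) - 1) ≤ (s - 1) * 3 ^ s * t ^ 2 := by
      rcases le_or_gt 0 t with h0 | h0
      · have h2 := rpow_one_add_sub_one_le (by linarith : 1 ≤ s - 1) (by linarith : -1 < t)
        have h4 : (1 + t) ^ (s - 1 - 1) ≤ 3 ^ s := by
          calc (1 + t) ^ (s - 1 - 1) ≤ 3 ^ (s - 1 - 1) :=
                Real.rpow_le_rpow (by linarith) (by linarith) (by linarith)
            _ ≤ 3 ^ s := Real.rpow_le_rpow_of_exponent_le (by norm_num) (by linarith)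
        calc t * ((1 + t) ^ (s - 1) - 1) ≤ t * ((s - 1) * t * 3 ^ s) := by
              refine mul_le_mul_of_nonneg_left (h2.trans ?_) h0
              exact mul_le_mul_of_nonneg_left h4 (mul_nonneg (by linarith) h0)
          _ = _ := by ring
      · have h2 := one_add_mul_self_le_rpow_one_add (by linarith : -1 ≤ t)
          (by linarith : 1 ≤ s - 1)
        have h4 : t * ((1 + t) ^ (s - 1) - 1) ≤ (s - 1) * t ^ 2 := by nlinarith
        have h5 : 0 ≤ (s - 1) * t ^ 2 := mul_nonneg (by linarith) (sq_nonneg _)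
        nlinarith
    have h6 : s * ((s - 1) * 3 ^ s * t ^ 2) ≤ s ^ 2 * 3 ^ s * t ^ 2 := by
      have : 0 ≤ s * 3 ^ s * t ^ 2 := by positivity
      nlinarith
    have h7 := mul_le_mul_of_nonneg_left key (by linarith : 0 ≤ s)
    nlinarith [mul_nonneg hC0 hts]
  · have h1 : |1 + t| ^ s ≤ 3 ^ s * |t| ^ s := by
      rw [← Real.mul_rpow (by norm_num) (abs_nonneg _)]
      refine Real.rpow_le_rpow (abs_nonneg _) ?_ (by linarith)
      have := abs_add_le 1 t
      rw [abs_one] at this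
      linarith
    have h2 : -1 - s * t ≤ 2 * s * t ^ 2 := by
      have h4 : |t| ≤ 2 * t ^ 2 := by rw [← sq_abs t]; nlinarith
      have h5 := neg_abs_le t
      nlinarith
    have h4 : 2 * s ≤ s ^ 2 * 3 ^ s := by nlinarith
    nlinarith [mul_le_mul_of_nonneg_right h4 (sq_nonneg t), mul_le_mul_of_nonneg_right hC3 hts]

theorem abs_add_rpow_le {s : ℝ} (hs : 2 ≤ s) (x y : ℝ) :
    |x + y| ^ s ≤ |x| ^ s + s * (x * |x| ^ (s - 2) * y) +
      s ^ 2 * 3 ^ s * (|x| ^ (s - 2) * y ^ 2 + |y| ^ s) := by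
  rcases eq_or_ne x 0 with rfl | hx
  · have h3 : (1 : ℝ) ≤ 3 ^ s := Real.one_le_rpow (by norm_num) (by linarith)
    have h0 : (0 : ℝ) ≤ |0| ^ (s - 2) := Real.rpow_nonneg (abs_nonneg _) _
    have hys : 0 ≤ |y| ^ s := Real.rpow_nonneg (abs_nonneg _) _
    have hC : 1 ≤ s ^ 2 * (3 : ℝ) ^ s := by nlinarith
    have h00 : (0 : ℝ) ≤ |0| ^ s := Real.rpow_nonneg (abs_nonneg _) _
    simp only [zero_add, zero_mul, mul_zero, add_zero]
    nlinarith [mul_nonneg h0 (sq_nonneg y), mul_nonneg (by linarith : 0 ≤ s ^ 2 * (3 : ℝ) ^ s)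
      (mul_nonneg h0 (sq_nonneg y))]
  · have hx0 : 0 < |x| := abs_pos.2 hx
    have h := mul_le_mul_of_nonneg_left (abs_one_add_rpow_le hs (y / x))
      (Real.rpow_nonneg hx0.le s)
    have hsplit : |x| ^ s = |x| ^ (s - 2) * x ^ 2 := by
      rw [← sq_abs x, ← Real.rpow_natCast |x| 2, ← Real.rpow_add hx0]
      norm_num
    have e1 : |x| ^ s * |1 + y / x| ^ s = |x + y| ^ s := by
      rw [← Real.mul_rpow hx0.le (abs_nonneg _), ← abs_mul]
      congr 2; field_simp
    have e2 : |x| ^ s * |y / x| ^ s = |y| ^ s := by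
      rw [← Real.mul_rpow hx0.le (abs_nonneg _), ← abs_mul]
      congr 2; field_simp
    have e3 : |x| ^ s * (y / x) = x * |x| ^ (s - 2) * y := by rw [hsplit]; field_simp
    have e4 : |x| ^ s * (y / x) ^ 2 = |x| ^ (s - 2) * y ^ 2 := by rw [hsplit]; field_simp
    calc |x + y| ^ s ≤ _ := e1 ▸ h
      _ = |x| ^ s + s * (|x| ^ s * (y / x)) + s ^ 2 * 3 ^ s *
          (|x| ^ s * (y / x) ^ 2 + |x| ^ s * |y / x| ^ s) := by ring
      _ = _ := by rw [e2, e3, e4]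

variable {Ω : Type*} [MeasurableSpace Ω] {P : Measure Ω} [IsProbabilityMeasure P]

omit [IsProbabilityMeasure P] in
theorem integrable_abs_rpow {s : ℝ} (hs : 0 < s) {f : Ω → ℝ} (hf : MemLp f (ENNReal.ofReal s) P) :
    Integrable (fun ω => |f ω| ^ s) P := by
  have := hf.integrable_norm_rpow (by simpa using hs) ENNReal.ofReal_ne_top
  simpa [ENNReal.toReal_ofReal hs.le] using this

theorem abs_rpow_le_one_add {a s : ℝ} (ha : 0 ≤ a) (has : a ≤ s) (x : ℝ) :
    |x| ^ a ≤ 1 + |x| ^ s := by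
  rcases le_or_gt |x| 1 with h | h
  · have := Real.rpow_le_one (abs_nonneg x) h ha
    have := Real.rpow_nonneg (abs_nonneg x) s
    linarith
  · have := Real.rpow_le_rpow_of_exponent_le h.le has
    linarith

/-- Lyapunov's inequality. -/
theorem integral_abs_rpow_le {a s : ℝ} (ha : 0 ≤ a) (has : a ≤ s) (hs : 0 < s) {f : Ω → ℝ}
    (hf : MemLp f (ENNReal.ofReal s) P) :
    ∫ ω, |f ω| ^ a ∂P ≤ (∫ ω, |f ω| ^ s ∂P) ^ (a / s) := by
  have hcomp : ∀ ω, |f ω| ^ a = (|f ω| ^ s) ^ (a / s) := fun ω => by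
    rw [← Real.rpow_mul (abs_nonneg _)]; congr 1; field_simp
  have hint := integrable_abs_rpow hs hf
  have hint' : Integrable (fun ω => |f ω| ^ a) P := by
    refine ((integrable_const 1).add hint).mono' ?_ ?_
    · exact (hf.1.aemeasurable.abs.pow_const a).aestronglyMeasurable
    · refine Filter.Eventually.of_forall fun ω => ?_
      rw [Real.norm_of_nonneg (Real.rpow_nonneg (abs_nonneg _) _)]
      exact abs_rpow_le_one_add ha has _
  simp_rw [hcomp]
  refine (Real.concaveOn_rpow (div_nonneg ha hs.le) ((div_le_one hs).2 has)).le_map_integral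
    ?_ isClosed_Ici ?_ hint ?_
  · exact fun x _ =>
      (Real.continuousAt_rpow_const x _ (Or.inr (div_nonneg ha hs.le))).continuousWithinAt
  · exact Filter.Eventually.of_forall fun ω => Real.rpow_nonneg (abs_nonneg _) _
  · simpa [Function.comp_def, ← hcomp] using hint'

/-- A constant `K` for which `𝔼|ξ₁ + ⋯ + ξₘ|^s ≤ (K m)^(s/2) M^s` whenever the `ξᵢ` are independent,
centred and have `𝔼|ξᵢ|^s ≤ M^s`. -/
def momentConstant (s : ℝ) : ℝ := 2 * (s ^ 2 * 3 ^ s)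

theorem momentConstant_pos {s : ℝ} (hs : 2 ≤ s) : 0 < momentConstant s := by
  have : (0 : ℝ) < 3 ^ s := Real.rpow_pos_of_pos (by norm_num) _
  unfold momentConstant
  positivity

/-- The inequality that carries the induction on the number of summands in
`integral_abs_sum_rpow_le`; it determines the choice of `momentConstant`. -/
theorem momentConstant_recursion {s : ℝ} (hs : 2 ≤ s) (m : ℕ) :
    (momentConstant s * m) ^ (s / 2) +
      s ^ 2 * 3 ^ s * ((momentConstant s * m) ^ (s / 2 - 1) + 1) ≤
      (momentConstant s * (m + 1 : ℕ)) ^ (s / 2) := by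
  set C := s ^ 2 * (3 : ℝ) ^ s with hC
  have h3 : (1 : ℝ) ≤ 3 ^ s := Real.one_le_rpow (by norm_num) (by linarith)
  have hC1 : 1 ≤ C := by rw [hC]; nlinarith
  have hh : 1 ≤ s / 2 := by linarith
  change (2 * C * m) ^ (s / 2) + C * ((2 * C * m) ^ (s / 2 - 1) + 1) ≤
    (2 * C * (m + 1 : ℕ)) ^ (s / 2)
  rcases Nat.eq_zero_or_pos m with rfl | hm
  · have h1 : (0 : ℝ) ^ (s / 2) = 0 := Real.zero_rpow (by linarith)
    have h2 : (0 : ℝ) ^ (s / 2 - 1) ≤ 1 := Real.rpow_le_one le_rfl zero_le_one (by linarith)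
    have h4 : 2 * C ≤ (2 * C) ^ (s / 2) := by
      simpa using Real.rpow_le_rpow_of_exponent_le (by linarith : 1 ≤ 2 * C) hh
    simp only [Nat.cast_zero, mul_zero, h1, zero_add, Nat.cast_one, mul_one]
    nlinarith
  · have hm1 : (1 : ℝ) ≤ m := by exact_mod_cast hm
    set x := 2 * C * (m : ℝ) with hx
    have hx1 : 1 ≤ x := by nlinarith
    have hxm : 2 * C * ((m + 1 : ℕ) : ℝ) = x * (1 + 1 / m) := by
      rw [hx]; push_cast; field_simp
    have hb := one_add_mul_self_le_rpow_one_add (s := 1 / (m : ℝ))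
      (by have : 0 ≤ 1 / (m : ℝ) := by positivity
          linarith) hh
    have hx0 : 0 < x ^ (s / 2) := Real.rpow_pos_of_pos (by linarith) _
    rw [hxm]
    have h5 : x ^ (s / 2) = x * x ^ (s / 2 - 1) := by
      rw [Real.rpow_sub_one (by linarith)]; field_simp
    have h6 : 1 ≤ x ^ (s / 2 - 1) := Real.one_le_rpow hx1 (by linarith)
    have h7 : x ^ (s / 2) * (1 / m) = 2 * C * x ^ (s / 2 - 1) := by
      rw [h5, hx]; field_simp
    have h8 : 1 + 1 / (m : ℝ) ≤ (1 + 1 / (m : ℝ)) ^ (s / 2) := by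
      refine le_trans ?_ hb
      have : 0 ≤ 1 / (m : ℝ) := by positivity
      nlinarith
    calc x ^ (s / 2) + C * (x ^ (s / 2 - 1) + 1) ≤ x ^ (s / 2) + 2 * C * x ^ (s / 2 - 1) := by
          nlinarith
      _ = x ^ (s / 2) * (1 + 1 / m) := by rw [mul_add, h7, mul_one]
      _ ≤ x ^ (s / 2) * (1 + 1 / (m : ℝ)) ^ (s / 2) := mul_le_mul_of_nonneg_left h8 hx0.le
      _ = _ := (Real.mul_rpow (by linarith) (by positivity)).symm

/-- A Marcinkiewicz–Zygmund (Rosenthal type) inequality, by induction on the number of summands: in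
the expansion `abs_add_rpow_le` the first-order term has mean zero by independence. -/
theorem integral_abs_sum_rpow_le {ι : Type*} {ξ : ι → Ω → ℝ} {s M : ℝ} (hs : 2 ≤ s) (hM : 0 ≤ M)
    (hind : iIndepFun ξ P) (hmeas : ∀ i, Measurable (ξ i))
    (hLp : ∀ i, MemLp (ξ i) (ENNReal.ofReal s) P) (hmean : ∀ i, ∫ ω, ξ i ω ∂P = 0)
    (hbd : ∀ i, ∫ ω, |ξ i ω| ^ s ∂P ≤ M ^ s) (T : Finset ι) :
    ∫ ω, |∑ i ∈ T, ξ i ω| ^ s ∂P ≤ (momentConstant s * T.card) ^ (s / 2) * M ^ s := by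
  classical
  have hs0 : 0 < s := by linarith
  induction T using Finset.induction_on with
  | empty =>
    simp [Real.zero_rpow hs0.ne', Real.zero_rpow (by positivity : s / 2 ≠ 0)]
  | insert a T ha ih =>
    set S : Ω → ℝ := fun ω => ∑ i ∈ T, ξ i ω with hS
    have hSLp : MemLp S (ENNReal.ofReal s) P := memLp_finsetSum T fun i _ => hLp i
    have hSm : Measurable S := Finset.measurable_sum T fun i _ => hmeas i
    have hind2 : IndepFun S (ξ a) P := by
      have := hind.indepFun_finsetSum_of_notMem hmeas ha
      convert this using 1
      ext ω; simp [hS]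
    have hK := momentConstant_pos hs
    have hint : ∀ b, 0 ≤ b → b ≤ s → ∀ f : Ω → ℝ, MemLp f (ENNReal.ofReal s) P →
        Integrable (fun ω => |f ω| ^ b) P := by
      intro b hb hbs f hf
      refine ((integrable_const 1).add (integrable_abs_rpow hs0 hf)).mono' ?_ ?_
      · exact (hf.1.aemeasurable.abs.pow_const b).aestronglyMeasurable
      · refine Filter.Eventually.of_forall fun ω => ?_
        rw [Real.norm_of_nonneg (Real.rpow_nonneg (abs_nonneg _) _)]
        exact abs_rpow_le_one_add hb hbs _
    have hψm : Measurable fun x : ℝ => x * |x| ^ (s - 2) := by fun_prop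
    have hψint : Integrable (fun ω => S ω * |S ω| ^ (s - 2)) P := by
      refine (hint (s - 1) (by linarith) (by linarith) S hSLp).mono'
        (hψm.comp hSm).aestronglyMeasurable (Filter.Eventually.of_forall fun ω => ?_)
      rw [Real.norm_eq_abs, abs_mul, abs_of_nonneg (Real.rpow_nonneg (abs_nonneg (S ω)) _)]
      rcases eq_or_ne (S ω) 0 with h0 | h0
      · rw [h0, abs_zero, zero_mul]; exact Real.rpow_nonneg le_rfl _
      · have : 0 < |S ω| := abs_pos.2 h0
        nth_rewrite 1 [← Real.rpow_one |S ω|]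
        rw [← Real.rpow_add this]
        apply le_of_eq; congr 1; ring
    have hξint : Integrable (ξ a) P := (hLp a).integrable (by
      rw [← ENNReal.ofReal_one]; exact ENNReal.ofReal_le_ofReal (by linarith))
    have hξ2 : Integrable (fun ω => ξ a ω ^ 2) P := by
      simpa using hint 2 (by norm_num) hs _ (hLp a)
    have hI1 : IndepFun (fun ω => S ω * |S ω| ^ (s - 2)) (ξ a) P := hind2.comp hψm measurable_id
    have hI2 : IndepFun (fun ω => |S ω| ^ (s - 2)) (fun ω => ξ a ω ^ 2) P :=
      hind2.comp (φ := fun x : ℝ => |x| ^ (s - 2)) (ψ := fun x : ℝ => x ^ 2)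
        (by fun_prop) (by fun_prop)
    have hSs2 := hint (s - 2) (by linarith) (by linarith) S hSLp
    have e1 : ∫ ω, S ω * |S ω| ^ (s - 2) * ξ a ω ∂P = 0 := by
      rw [hI1.integral_fun_mul_eq_mul_integral hψint.1 hξint.1, hmean a, mul_zero]
    have e2 : ∫ ω, |S ω| ^ (s - 2) * ξ a ω ^ 2 ∂P =
        (∫ ω, |S ω| ^ (s - 2) ∂P) * ∫ ω, ξ a ω ^ 2 ∂P :=
      hI2.integral_fun_mul_eq_mul_integral hSs2.1 hξ2.1
    have i1 : Integrable (fun ω => S ω * |S ω| ^ (s - 2) * ξ a ω) P :=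
      hI1.integrable_mul hψint hξint
    have i2 : Integrable (fun ω => |S ω| ^ (s - 2) * ξ a ω ^ 2) P := hI2.integrable_mul hSs2 hξ2
    have i3 := integrable_abs_rpow hs0 hSLp
    have i4 := integrable_abs_rpow hs0 (hLp a)
    have j1 : Integrable (fun ω => |S ω| ^ s + s * (S ω * |S ω| ^ (s - 2) * ξ a ω)) P :=
      i3.add (i1.const_mul s)
    have j2 : Integrable (fun ω => |S ω| ^ (s - 2) * ξ a ω ^ 2 + |ξ a ω| ^ s) P := i2.add i4
    have hcard : (insert a T).card = T.card + 1 := Finset.card_insert_of_notMem ha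
    have hstep : ∫ ω, |∑ i ∈ insert a T, ξ i ω| ^ s ∂P ≤ ∫ ω, |S ω| ^ s ∂P +
        s ^ 2 * 3 ^ s * ((∫ ω, |S ω| ^ (s - 2) ∂P) * (∫ ω, ξ a ω ^ 2 ∂P) +
          ∫ ω, |ξ a ω| ^ s ∂P) := by
      calc ∫ ω, |∑ i ∈ insert a T, ξ i ω| ^ s ∂P
          ≤ ∫ ω, (|S ω| ^ s + s * (S ω * |S ω| ^ (s - 2) * ξ a ω)) +
              s ^ 2 * 3 ^ s * (|S ω| ^ (s - 2) * ξ a ω ^ 2 + |ξ a ω| ^ s) ∂P := by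
            refine integral_mono (integrable_abs_rpow hs0 (memLp_finsetSum _ fun i _ => hLp i))
              (j1.add (j2.const_mul _)) fun ω => ?_
            simp only [Finset.sum_insert ha]
            rw [add_comm (ξ a ω)]
            exact abs_add_rpow_le hs _ _
        _ = _ := by
            rw [integral_add j1 (j2.const_mul _),
              integral_add i3 (i1.const_mul s), integral_const_mul, integral_const_mul,
              integral_add i2 i4, e1, e2]
            ring
    have hM2 : ∫ ω, ξ a ω ^ 2 ∂P ≤ M ^ 2 := by
      have h1 := integral_abs_rpow_le (by norm_num : (0 : ℝ) ≤ 2) hs hs0 (hLp a)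
      simp only [Real.rpow_two, sq_abs] at h1
      refine h1.trans ?_
      calc (∫ ω, |ξ a ω| ^ s ∂P) ^ (2 / s) ≤ (M ^ s) ^ (2 / s) :=
            Real.rpow_le_rpow (integral_nonneg fun ω => Real.rpow_nonneg (abs_nonneg _) _)
              (hbd a) (by positivity)
        _ = M ^ 2 := by
            rw [← Real.rpow_mul hM, mul_div_cancel₀ _ hs0.ne', Real.rpow_two]
    have hKm : 0 ≤ momentConstant s * T.card := by positivity
    have hSm2 : ∫ ω, |S ω| ^ (s - 2) ∂P ≤
        (momentConstant s * T.card) ^ (s / 2 - 1) * M ^ (s - 2) := by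
      refine (integral_abs_rpow_le (by linarith) (by linarith) hs0 hSLp).trans ?_
      calc (∫ ω, |S ω| ^ s ∂P) ^ ((s - 2) / s)
          ≤ ((momentConstant s * T.card) ^ (s / 2) * M ^ s) ^ ((s - 2) / s) :=
            Real.rpow_le_rpow (integral_nonneg fun ω => Real.rpow_nonneg (abs_nonneg _) _)
              ih (div_nonneg (by linarith) hs0.le)
        _ = _ := by
            rw [Real.mul_rpow (Real.rpow_nonneg hKm _) (Real.rpow_nonneg hM _),
              ← Real.rpow_mul hKm, ← Real.rpow_mul hM]
            congr 2 <;> field_simp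
    have hMs : M ^ (s - 2) * M ^ 2 = M ^ s := by
      rw [← Real.rpow_two, ← Real.rpow_add_of_nonneg hM (by linarith) (by norm_num)]
      congr 1; ring
    have hrec := momentConstant_recursion hs T.card
    have hMs0 : 0 ≤ M ^ s := Real.rpow_nonneg hM _
    rw [hcard]
    refine hstep.trans ?_
    have hprod : (∫ ω, |S ω| ^ (s - 2) ∂P) * (∫ ω, ξ a ω ^ 2 ∂P) ≤
        (momentConstant s * T.card) ^ (s / 2 - 1) * M ^ s := by
      rw [← hMs, ← mul_assoc]
      exact mul_le_mul hSm2 hM2 (integral_nonneg fun ω => sq_nonneg _)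
        (mul_nonneg (Real.rpow_nonneg hKm _) (Real.rpow_nonneg hM _))
    calc _ ≤ (momentConstant s * T.card) ^ (s / 2) * M ^ s +
          s ^ 2 * 3 ^ s * ((momentConstant s * T.card) ^ (s / 2 - 1) * M ^ s + M ^ s) := by
          refine add_le_add ih (mul_le_mul_of_nonneg_left (add_le_add hprod (hbd a)) ?_)
          positivity
      _ = ((momentConstant s * T.card) ^ (s / 2) +
          s ^ 2 * 3 ^ s * ((momentConstant s * T.card) ^ (s / 2 - 1) + 1)) * M ^ s := by ring
      _ ≤ _ := mul_le_mul_of_nonneg_right hrec hMs0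

end Moments

/-! ### Independence of pairs and conditioning -/

section Independence

variable {Ω : Type*} [mΩ : MeasurableSpace Ω] {P : Measure Ω}

/-- If the families `U` and `W` are each independent, and independent of one another, then the pairs
`(U i, W i)` are independent. -/
theorem iIndepFun_prodMk {ι α β : Type*} [MeasurableSpace α] [MeasurableSpace β]
    {U : ι → Ω → α} {W : ι → Ω → β} (hU : iIndepFun U P) (hW : iIndepFun W P)
    (hUm : ∀ i, Measurable (U i)) (hWm : ∀ i, Measurable (W i))
    (hUW : IndepFun (fun ω i => U i ω) (fun ω i => W i ω) P) :
    iIndepFun (fun i ω => (U i ω, W i ω)) P := by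
  rw [iIndepFun_iff_iIndep]
  let R : Set (Set (α × β)) :=
    Set.image2 (fun s t => s ×ˢ t) {s | MeasurableSet s} {t | MeasurableSet t}
  refine iIndepSets.iIndep (fun i => ((hUm i).prodMk (hWm i)).comap_le)
    (fun i => {s | ∃ t ∈ R, (fun ω => (U i ω, W i ω)) ⁻¹' t = s})
    (fun i => isPiSystem_prod.comap _) (fun i => ?_) ?_
  · change MeasurableSpace.comap _ Prod.instMeasurableSpace = _
    rw [← generateFrom_prod, MeasurableSpace.comap_generateFrom]
    rfl
  rw [iIndepSets_iff]
  intro s f hf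
  choose! t ht htf using hf
  choose! A hA B hB hAB using ht
  have hfi : ∀ i ∈ s, f i = U i ⁻¹' A i ∩ W i ⁻¹' B i := by
    intro i hi
    rw [← htf i hi, ← hAB i hi]
    rfl
  have hinter : ⋂ i ∈ s, f i = (⋂ i ∈ s, U i ⁻¹' A i) ∩ ⋂ i ∈ s, W i ⁻¹' B i := by
    rw [Set.iInter₂_congr hfi]
    ext ω
    simp only [Set.mem_iInter, Set.mem_inter_iff]
    exact ⟨fun h => ⟨fun i hi => (h i hi).1, fun i hi => (h i hi).2⟩,
      fun h i hi => ⟨h.1 i hi, h.2 i hi⟩⟩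
  have hpre1 : ⋂ i ∈ s, U i ⁻¹' A i = (fun ω i => U i ω) ⁻¹' ⋂ i ∈ s, Function.eval i ⁻¹' A i := by
    ext ω; simp
  have hpre2 : ⋂ i ∈ s, W i ⁻¹' B i = (fun ω i => W i ω) ⁻¹' ⋂ i ∈ s, Function.eval i ⁻¹' B i := by
    ext ω; simp
  rw [hinter]
  nth_rewrite 1 [hpre1]
  nth_rewrite 1 [hpre2]
  rw [hUW.measure_inter_preimage_eq_mul, ← hpre1, ← hpre2,
    hU.meas_biInter fun i hi => ⟨A i, hA i hi, rfl⟩,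
    hW.meas_biInter fun i hi => ⟨B i, hB i hi, rfl⟩,
    ← Finset.prod_mul_distrib]
  · refine Finset.prod_congr rfl fun i hi => ?_
    rw [hfi i hi]
    have : IndepFun (U i) (W i) P :=
      hUW.comp (φ := fun u : ι → α => u i) (ψ := fun w : ι → β => w i)
        (measurable_pi_apply i) (measurable_pi_apply i)
    exact (this.measure_inter_preimage_eq_mul _ _ (hA i hi) (hB i hi)).symm
  · exact Finset.measurableSet_biInter _ fun i hi => measurable_pi_apply i (hA i hi)
  · exact Finset.measurableSet_biInter _ fun i hi => measurable_pi_apply i (hB i hi)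

/-- Freezing an independent variable: a bound on the expectation of `g (z, W)` uniform in `z` bounds
the expectation of `g (Z, W)` if `Z` and `W` are independent. -/
theorem lintegral_comp_le_of_indepFun [IsProbabilityMeasure P] {α β : Type*} [MeasurableSpace α]
    [MeasurableSpace β] {Z : Ω → α} {W : Ω → β} (hZ : Measurable Z) (hW : Measurable W)
    (hZW : IndepFun Z W P) {g : α × β → ℝ≥0∞} (hg : Measurable g) {C : ℝ≥0∞}
    (hC : ∀ z, ∫⁻ ω, g (z, W ω) ∂P ≤ C) : ∫⁻ ω, g (Z ω, W ω) ∂P ≤ C := by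
  have := Measure.isProbabilityMeasure_map (μ := P) hZ.aemeasurable
  have := Measure.isProbabilityMeasure_map (μ := P) hW.aemeasurable
  calc ∫⁻ ω, g (Z ω, W ω) ∂P = ∫⁻ a, g a ∂(P.map fun ω => (Z ω, W ω)) :=
        (lintegral_map hg (hZ.prodMk hW)).symm
    _ = ∫⁻ z, ∫⁻ w, g (z, w) ∂(P.map W) ∂(P.map Z) := by
        rw [hZW.map_prod_eq_prod_map_map hZ.aemeasurable hW.aemeasurable,
          lintegral_prod _ hg.aemeasurable]
    _ ≤ ∫⁻ _z, C ∂(P.map Z) := by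
        refine lintegral_mono fun z => ?_
        have e : ∫⁻ w, g (z, w) ∂(P.map W) = ∫⁻ ω, g (z, W ω) ∂P :=
          lintegral_map (f := fun w => g (z, w)) (hg.comp measurable_prodMk_left) hW
        exact e.trans_le (hC z)
    _ = C := by simp

end Independence

/-! ### Absolute moments of products -/

section ProductMoments

variable {Ω : Type*} [MeasurableSpace Ω] {P : Measure Ω} [IsProbabilityMeasure P]

theorem abs_add_rpow_le_two {s : ℝ} (hs : 0 ≤ s) (x y : ℝ) :
    |x + y| ^ s ≤ 2 ^ s * (|x| ^ s + |y| ^ s) := by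
  have h : |x + y| ≤ 2 * max |x| |y| := by
    have := abs_add_le x y
    have := le_max_left |x| |y|
    have := le_max_right |x| |y|
    linarith
  have hx := Real.rpow_nonneg (abs_nonneg x) s
  have hy := Real.rpow_nonneg (abs_nonneg y) s
  refine (Real.rpow_le_rpow (abs_nonneg _) h hs).trans ?_
  rw [Real.mul_rpow (by norm_num) (le_max_of_le_left (abs_nonneg _))]
  refine mul_le_mul_of_nonneg_left ?_ (Real.rpow_nonneg (by norm_num) _)
  rcases max_choice |x| |y| with h | h <;> rw [h] <;> linarith

omit [IsProbabilityMeasure P] in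
theorem memLp_of_integrable_abs_rpow {s : ℝ} (hs : 0 < s) {f : Ω → ℝ} (hf : Measurable f)
    (h : Integrable (fun ω => |f ω| ^ s) P) : MemLp f (ENNReal.ofReal s) P := by
  rw [← integrable_norm_rpow_iff hf.aestronglyMeasurable (by simpa using hs)
    ENNReal.ofReal_ne_top, ENNReal.toReal_ofReal hs.le]
  exact h

omit [IsProbabilityMeasure P] in
theorem integrable_abs_rpow_of_lintegral {s : ℝ} {f : Ω → ℝ}
    (hf : Measurable f) (hs : 0 ≤ s) {C : ℝ≥0∞} (hC : C < ∞) (h : ∫⁻ ω, ‖f ω‖ₑ ^ s ∂P ≤ C) :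
    Integrable (fun ω => |f ω| ^ s) P ∧ ∫ ω, |f ω| ^ s ∂P ≤ C.toReal := by
  have hm : Measurable fun ω => |f ω| ^ s := by fun_prop
  have he : ∀ ω, ENNReal.ofReal (|f ω| ^ s) = ‖f ω‖ₑ ^ s := fun ω => by
    rw [← ENNReal.ofReal_rpow_of_nonneg (abs_nonneg _) hs, ← Real.norm_eq_abs, ofReal_norm]
  constructor
  · refine ⟨hm.aestronglyMeasurable, ?_⟩
    rw [hasFiniteIntegral_iff_ofReal
      (Filter.Eventually.of_forall fun ω => Real.rpow_nonneg (abs_nonneg _) _)]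
    simp_rw [he]
    exact h.trans_lt hC
  · rw [integral_eq_lintegral_of_nonneg_ae
      (Filter.Eventually.of_forall fun ω => Real.rpow_nonneg (abs_nonneg _) _)
      hm.aestronglyMeasurable]
    simp_rw [he]
    exact ENNReal.toReal_mono hC.ne h

/-- Centred products of variables with `2s` moments have `s` moments. -/
theorem centered_product_moment {s W : ℝ} (hs : 1 ≤ s) {a b : Ω → ℝ} (ha : Measurable a)
    (hb : Measurable b) (hai : Integrable (fun ω => |a ω| ^ (2 * s)) P)
    (hbi : Integrable (fun ω => |b ω| ^ (2 * s)) P) (haW : ∫ ω, |a ω| ^ (2 * s) ∂P ≤ W)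
    (hbW : ∫ ω, |b ω| ^ (2 * s) ∂P ≤ W) :
    MemLp (fun ω => a ω * b ω - ∫ ω, a ω * b ω ∂P) (ENNReal.ofReal s) P ∧
      ∫ ω, |a ω * b ω - ∫ ω, a ω * b ω ∂P| ^ s ∂P ≤ 2 * 2 ^ s * W := by
  have hs0 : 0 < s := by linarith
  have hpt : ∀ ω, |a ω * b ω| ^ s ≤ (|a ω| ^ (2 * s) + |b ω| ^ (2 * s)) / 2 := fun ω => by
    have h2 : ∀ x : ℝ, |x| ^ (2 * s) = (|x| ^ s) ^ 2 := fun x => by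
      rw [← Real.rpow_natCast, ← Real.rpow_mul (abs_nonneg _)]; congr 1; push_cast; ring
    rw [abs_mul, Real.mul_rpow (abs_nonneg _) (abs_nonneg _), h2, h2]
    nlinarith [sq_nonneg (|a ω| ^ s - |b ω| ^ s)]
  have hi : Integrable (fun ω => |a ω * b ω| ^ s) P := by
    refine ((hai.add hbi).div_const 2).mono'
      ((ha.mul hb).abs.pow_const s).aestronglyMeasurable (Filter.Eventually.of_forall fun ω => ?_)
    rw [Real.norm_of_nonneg (Real.rpow_nonneg (abs_nonneg _) _)]
    exact hpt ω
  have hiW : ∫ ω, |a ω * b ω| ^ s ∂P ≤ W := by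
    calc _ ≤ ∫ ω, (|a ω| ^ (2 * s) + |b ω| ^ (2 * s)) / 2 ∂P :=
          integral_mono hi ((hai.add hbi).div_const 2) hpt
      _ = ((∫ ω, |a ω| ^ (2 * s) ∂P) + ∫ ω, |b ω| ^ (2 * s) ∂P) / 2 := by
          rw [integral_div, integral_add hai hbi]
      _ ≤ W := by linarith
  have hab := memLp_of_integrable_abs_rpow hs0 (ha.mul hb) hi
  set c := ∫ ω, a ω * b ω ∂P with hc
  have hm : MemLp (fun ω => a ω * b ω - c) (ENNReal.ofReal s) P := hab.sub (memLp_const c)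
  refine ⟨hm, ?_⟩
  have hcs : |c| ^ s ≤ W := by
    have h1 : |c| ≤ ∫ ω, |a ω * b ω| ^ (1 : ℝ) ∂P := by
      simp only [Real.rpow_one]; exact abs_integral_le_integral_abs
    have h2 := h1.trans (integral_abs_rpow_le zero_le_one hs hs0 hab)
    have h3 := Real.rpow_le_rpow (abs_nonneg _) h2 hs0.le
    rw [← Real.rpow_mul (integral_nonneg fun ω => Real.rpow_nonneg (abs_nonneg _) _),
      div_mul_cancel₀ _ hs0.ne', Real.rpow_one] at h3
    exact h3.trans hiW
  calc _ ≤ ∫ ω, 2 ^ s * (|a ω * b ω| ^ s + |c| ^ s) ∂P := by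
        refine integral_mono (integrable_abs_rpow hs0 hm)
          ((hi.add (integrable_const _)).const_mul _) fun ω => ?_
        simpa [sub_eq_add_neg] using abs_add_rpow_le_two hs0.le (a ω * b ω) (-c)
    _ = 2 ^ s * ((∫ ω, |a ω * b ω| ^ s ∂P) + |c| ^ s) := by
        rw [integral_const_mul, integral_add hi (integrable_const _)]; simp
    _ ≤ 2 ^ s * (W + W) := by gcongr
    _ = _ := by ring

end ProductMoments

/-! ### Moments of the deviation of the data Gram matrix -/

section Deviation

/-- The deviation of `p⁻¹ Y Yᵀ` from its mean `(f (z i) (z k) + σ² 1_{i = k})` when the latent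
positions are frozen at `z`. The sample space `β` carries no structure here, because joint
measurability is needed with respect to a σ-algebra smaller than the ambient one. -/
def gramDeviation {𝒵 β : Type*} {n p : ℕ} (σ : ℝ) (f : 𝒵 → 𝒵 → ℝ) (X : Fin p → 𝒵 → β → ℝ)
    (E : Fin n → Fin p → β → ℝ) (z : Fin n → 𝒵) (ω : β) : Matrix (Fin n) (Fin n) ℝ :=
  Matrix.of fun i k => (1 / (p : ℝ)) *
    ∑ j, (X j (z i) ω + σ * E i j ω) * (X j (z k) ω + σ * E k j ω) -
      (f (z i) (z k) + if i = k then σ ^ 2 else 0)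

theorem measurable_gramDeviation {𝒵 β : Type*} [MeasurableSpace 𝒵] [MeasurableSpace β] {n p : ℕ}
    {σ : ℝ} {f : 𝒵 → 𝒵 → ℝ} {X : Fin p → 𝒵 → β → ℝ} {E : Fin n → Fin p → β → ℝ}
    (hf : Measurable fun a : 𝒵 × 𝒵 => f a.1 a.2)
    (hX : ∀ j, Measurable fun a : 𝒵 × β => X j a.1 a.2) (hE : ∀ i j, Measurable (E i j))
    (i k : Fin n) :
    Measurable fun a : (Fin n → 𝒵) × β => gramDeviation σ f X E a.1 a.2 i k := by
  have hX' : ∀ j i, Measurable fun a : (Fin n → 𝒵) × β => X j (a.1 i) a.2 := fun j i =>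
    show Measurable ((fun a : 𝒵 × β => X j a.1 a.2) ∘ fun a : (Fin n → 𝒵) × β => (a.1 i, a.2)) from
      (hX j).comp (((measurable_pi_apply i).comp measurable_fst).prodMk measurable_snd)
  have hE' : ∀ i j, Measurable fun a : (Fin n → 𝒵) × β => E i j a.2 := fun i j =>
    (hE i j).comp measurable_snd
  have hf' : Measurable fun a : (Fin n → 𝒵) × β => f (a.1 i) (a.1 k) :=
    show Measurable ((fun a : 𝒵 × 𝒵 => f a.1 a.2) ∘
        fun a : (Fin n → 𝒵) × β => (a.1 i, a.1 k)) from
      hf.comp (((measurable_pi_apply i).comp measurable_fst).prodMk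
        ((measurable_pi_apply k).comp measurable_fst))
  simp only [gramDeviation, Matrix.of_apply]
  refine Measurable.sub (Measurable.const_mul (Finset.measurable_sum _ fun j _ => ?_) _)
    (hf'.add_const _)
  exact ((hX' j i).add ((hE' i j).const_mul σ)).mul ((hX' j k).add ((hE' k j).const_mul σ))

variable {𝒵 Ω : Type*} [MeasurableSpace 𝒵] [mΩ : MeasurableSpace Ω] {P : Measure Ω}
  [IsProbabilityMeasure P] {μ : Measure 𝒵} {n p : ℕ} {Z : Fin n → Ω → 𝒵} {X : Fin p → 𝒵 → Ω → ℝ}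
  {E : Fin n → Fin p → Ω → ℝ} {σ q : ℝ}

/-- A level `L` such that the `2q`-th absolute moment of every entry of `gramDeviation` is at most
`(L / p) ^ q`, in terms of bounds `M` and `N` for the `4q`-th moments of the fields and of the
noise, and of the noise variance `s = σ²`. -/
def noiseLevel (q M N s : ℝ) : ℝ :=
  momentConstant (2 * q) * (2 * 2 ^ (2 * q) * (2 ^ (4 * q) * (M + s ^ (2 * q) * N))) ^ (1 / q)

omit mΩ in
theorem measurable_comap_entry (i : Fin n) (j : Fin p) :
    Measurable[MeasurableSpace.comap (fun ω i j => E i j ω) MeasurableSpace.pi] (E i j) := by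
  have h1 := comap_measurable (m := MeasurableSpace.pi) (fun ω i j => E i j ω)
  have h2 : Measurable fun e : Fin n → Fin p → ℝ => e i j := by fun_prop
  exact h2.comp h1

omit [IsProbabilityMeasure P] in
theorem IsModel.measurable_field (h : IsModel P μ Z X E) (j : Fin p) (z : 𝒵) :
    Measurable (X j z) := by
  obtain ⟨𝓖, hle, hX, -⟩ := h.indep_sources
  exact Measurable.mono
    ((hX j).comp (@measurable_prodMk_left _ _ _ 𝓖 z)) hle le_rfl

omit [IsProbabilityMeasure P] in
theorem IsModel.indepFun_field_noise (h : IsModel P μ Z X E) (z z' : 𝒵) (i k : Fin n) :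
    IndepFun (fun ω j => (X j z ω, X j z' ω)) (fun ω j => (E i j ω, E k j ω)) P := by
  obtain ⟨𝓖, hle, hX, hind⟩ := h.indep_sources
  have h12 := hind.indep (i := 1) (j := 2) (by decide)
  simp only [Matrix.cons_val_one, Matrix.cons_val_zero, Matrix.cons_val] at h12
  rw [IndepFun_iff_Indep]
  refine indep_of_indep_of_le_left (indep_of_indep_of_le_right h12 ?_) ?_
  · rw [← measurable_iff_comap_le]
    exact @measurable_pi_lambda _ _ _ (MeasurableSpace.comap _ _) _ _ fun j =>
      (measurable_comap_entry i j).prodMk (measurable_comap_entry k j)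
  · rw [← measurable_iff_comap_le]
    have hX' : ∀ j z, Measurable[𝓖] (X j z) := fun j z =>
      (hX j).comp (@measurable_prodMk_left _ _ _ 𝓖 z)
    exact @measurable_pi_lambda _ _ _ 𝓖 _ _ fun j => (hX' j z).prodMk (hX' j z')

omit [IsProbabilityMeasure P] in
theorem IsModel.iIndepFun_entries (h : IsModel P μ Z X E) (z z' : 𝒵) (i k : Fin n) :
    iIndepFun (fun j ω => (((X j z ω, X j z' ω), (E i j ω, E k j ω)) : (ℝ × ℝ) × ℝ × ℝ)) P := by
  refine iIndepFun_prodMk ?_ ?_ ?_ ?_ (h.indepFun_field_noise z z' i k)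
  · exact h.indep_field.comp (fun _ g => (g z, g z')) fun _ =>
      (measurable_pi_apply z).prodMk (measurable_pi_apply z')
  · exact h.indep_noise_columns.comp (fun _ g => (g i, g k)) fun _ =>
      (measurable_pi_apply i).prodMk (measurable_pi_apply k)
  · exact fun j => (h.measurable_field j z).prodMk (h.measurable_field j z')
  · exact fun j => (h.measurable_noise i j).prodMk (h.measurable_noise k j)

omit [IsProbabilityMeasure P] in
theorem IsModel.memLp_noise (h : IsModel P μ Z X E) (i : Fin n) (j : Fin p) :
    MemLp (E i j) 2 P := by
  rw [memLp_two_iff_integrable_sq (h.measurable_noise i j).aestronglyMeasurable]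
  by_contra hc
  have := h.variance_noise i j
  rw [integral_undef hc] at this
  exact zero_ne_one this

omit [IsProbabilityMeasure P] in
theorem IsModel.integral_entry_mul (h : IsModel P μ Z X E) (z z' : 𝒵) (i k : Fin n) (j : Fin p) :
    ∫ ω, (X j z ω + σ * E i j ω) * (X j z' ω + σ * E k j ω) ∂P =
      (∫ ω, X j z ω * X j z' ω ∂P) + if i = k then σ ^ 2 else 0 := by
  have hXX : Integrable (fun ω => X j z ω * X j z' ω) P :=
    (h.memLp_field j z).integrable_mul (h.memLp_field j z')
  have hEE : Integrable (fun ω => E i j ω * E k j ω) P :=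
    (h.memLp_noise i j).integrable_mul (h.memLp_noise k j)
  have hXE : Integrable (fun ω => X j z ω * E k j ω) P :=
    (h.memLp_field j z).integrable_mul (h.memLp_noise k j)
  have hEX : Integrable (fun ω => X j z' ω * E i j ω) P :=
    (h.memLp_field j z').integrable_mul (h.memLp_noise i j)
  have hcross : ∀ z i, ∫ ω, X j z ω * E i j ω ∂P = 0 := by
    intro z i
    have hI : IndepFun (X j z) (E i j) P :=
      (h.indepFun_field_noise z z i i).comp (φ := fun g : Fin p → ℝ × ℝ => (g j).1)
        (ψ := fun g : Fin p → ℝ × ℝ => (g j).1) (measurable_fst.comp (measurable_pi_apply j))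
        (measurable_fst.comp (measurable_pi_apply j))
    rw [hI.integral_fun_mul_eq_mul_integral (h.memLp_field j z).1 (h.memLp_noise i j).1,
      h.mean_noise, mul_zero]
  have hEEv : ∫ ω, E i j ω * E k j ω ∂P = if i = k then 1 else 0 := by
    split_ifs with hik
    · subst hik
      simpa [sq] using h.variance_noise i j
    · exact h.uncorrelated_noise_rows i k hik j j
  have hexp : ∀ ω, (X j z ω + σ * E i j ω) * (X j z' ω + σ * E k j ω) =
      X j z ω * X j z' ω + σ * (X j z ω * E k j ω) + σ * (X j z' ω * E i j ω) +
        σ ^ 2 * (E i j ω * E k j ω) := fun ω => by ring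
  have a1 : Integrable (fun ω => X j z ω * X j z' ω + σ * (X j z ω * E k j ω)) P :=
    hXX.add (hXE.const_mul σ)
  have a2 : Integrable (fun ω => X j z ω * X j z' ω + σ * (X j z ω * E k j ω) +
      σ * (X j z' ω * E i j ω)) P := a1.add (hEX.const_mul σ)
  simp_rw [hexp]
  rw [integral_add a2 (hEE.const_mul _), integral_add a1 (hEX.const_mul _),
    integral_add hXX (hXE.const_mul _)]
  simp only [integral_const_mul, hcross, hEEv]
  split_ifs <;> ring

omit [IsProbabilityMeasure P] in
theorem IsModel.entry_moment (h : IsModel P μ Z X E) (hq : 1 ≤ q)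
    (hM : fieldMoment P X (4 * q) < ∞) (hN : noiseMoment P E (4 * q) < ∞)
    (z : 𝒵) (i : Fin n) (j : Fin p) :
    Integrable (fun ω => |X j z ω + σ * E i j ω| ^ (4 * q)) P ∧
    ∫ ω, |X j z ω + σ * E i j ω| ^ (4 * q) ∂P ≤ 2 ^ (4 * q) *
      ((fieldMoment P X (4 * q)).toReal +
        (σ ^ 2) ^ (2 * q) * (noiseMoment P E (4 * q)).toReal) := by
  have hX := integrable_abs_rpow_of_lintegral (h.measurable_field j z) (by linarith : 0 ≤ 4 * q) hM
    (le_iSup₂_of_le (f := fun j z => ∫⁻ ω, ‖X j z ω‖ₑ ^ (4 * q) ∂P) j z le_rfl)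
  have hE := integrable_abs_rpow_of_lintegral (h.measurable_noise i j) (by linarith : 0 ≤ 4 * q) hN
    (le_iSup₂_of_le (f := fun i j => ∫⁻ ω, ‖E i j ω‖ₑ ^ (4 * q) ∂P) i j le_rfl)
  have hσ : |σ| ^ (4 * q) = (σ ^ 2) ^ (2 * q) := by
    rw [← sq_abs, ← Real.rpow_natCast, ← Real.rpow_mul (abs_nonneg _)]
    congr 1; push_cast; ring
  have hσ0 : 0 ≤ (σ ^ 2) ^ (2 * q) := Real.rpow_nonneg (sq_nonneg _) _
  have hpt : ∀ ω, |X j z ω + σ * E i j ω| ^ (4 * q) ≤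
      2 ^ (4 * q) * (|X j z ω| ^ (4 * q) + (σ ^ 2) ^ (2 * q) * |E i j ω| ^ (4 * q)) := fun ω => by
    rw [← hσ, ← Real.mul_rpow (abs_nonneg _) (abs_nonneg _), ← abs_mul]
    exact abs_add_rpow_le_two (by linarith) _ _
  have hb := (hX.1.add (hE.1.const_mul ((σ ^ 2) ^ (2 * q)))).const_mul (2 ^ (4 * q))
  have hXm := h.measurable_field j z
  have hEm := h.measurable_noise i j
  have hi : Integrable (fun ω => |X j z ω + σ * E i j ω| ^ (4 * q)) P := by
    refine hb.mono' ((hXm.add (hEm.const_mul σ)).abs.pow_const _).aestronglyMeasurable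
      (Filter.Eventually.of_forall fun ω => ?_)
    rw [Real.norm_of_nonneg (Real.rpow_nonneg (abs_nonneg _) _)]
    exact hpt ω
  refine ⟨hi, (integral_mono hi hb hpt).trans ?_⟩
  simp only [Pi.add_apply]
  rw [integral_const_mul, integral_add hX.1 (hE.1.const_mul _), integral_const_mul]
  have := hX.2
  have := mul_le_mul_of_nonneg_left hE.2 hσ0
  gcongr

/-- The entries of the deviation are normalized sums of independent centred products of two data
entries, one for each column. -/
theorem IsModel.gramDeviation_moment (h : IsModel P μ Z X E) (hp : 0 < p) (hq : 1 ≤ q)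
    (hM : fieldMoment P X (4 * q) < ∞) (hN : noiseMoment P E (4 * q) < ∞)
    (z : Fin n → 𝒵) (i k : Fin n) :
    MemLp (fun ω => gramDeviation σ (meanCorrelationKernel P X) X E z ω i k)
      (ENNReal.ofReal (2 * q)) P ∧
    ∫ ω, |gramDeviation σ (meanCorrelationKernel P X) X E z ω i k| ^ (2 * q) ∂P ≤
      (noiseLevel q (fieldMoment P X (4 * q)).toReal (noiseMoment P E (4 * q)).toReal (σ ^ 2) / p)
        ^ q := by
  set W := 2 ^ (4 * q) * ((fieldMoment P X (4 * q)).toReal +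
        (σ ^ 2) ^ (2 * q) * (noiseMoment P E (4 * q)).toReal) with hW
  have hW0 : 0 ≤ W := by positivity
  have hq0 : 0 < q := by linarith
  have hp0 : (0 : ℝ) < p := by exact_mod_cast hp
  let ab : Fin p → Ω → ℝ := fun j ω => (X j (z i) ω + σ * E i j ω) * (X j (z k) ω + σ * E k j ω)
  let ξ : Fin p → Ω → ℝ := fun j ω => ab j ω - ∫ ω, ab j ω ∂P
  have habm : ∀ j, Measurable (ab j) := fun j => by
    have := h.measurable_field j
    have := h.measurable_noise
    fun_prop
  have hdev : ∀ ω, gramDeviation σ (meanCorrelationKernel P X) X E z ω i k =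
      (1 / (p : ℝ)) * ∑ j, ξ j ω := by
    intro ω
    simp only [gramDeviation, meanCorrelationKernel, Matrix.of_apply, ξ, ab, h.integral_entry_mul,
      Finset.sum_sub_distrib, Finset.sum_add_distrib, Finset.sum_const, Finset.card_univ,
      Fintype.card_fin, nsmul_eq_mul]
    field_simp
  have hmom : ∀ j, MemLp (ξ j) (ENNReal.ofReal (2 * q)) P ∧
      ∫ ω, |ξ j ω| ^ (2 * q) ∂P ≤ 2 * 2 ^ (2 * q) * W := by
    intro j
    have h1 := h.entry_moment (σ := σ) hq hM hN (z i) i j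
    have h2 := h.entry_moment (σ := σ) hq hM hN (z k) k j
    have e : 4 * q = 2 * (2 * q) := by ring
    rw [← hW] at h1 h2
    rw [e] at h1 h2
    exact centered_product_moment (by linarith)
      ((h.measurable_field j (z i)).add ((h.measurable_noise i j).const_mul σ))
      ((h.measurable_field j (z k)).add ((h.measurable_noise k j).const_mul σ))
      h1.1 h2.1 h1.2 h2.2
  have hind : iIndepFun ξ P := by
    refine (h.iIndepFun_entries (z i) (z k) i k).comp
      (fun j (a : (ℝ × ℝ) × ℝ × ℝ) => (a.1.1 + σ * a.2.1) * (a.1.2 + σ * a.2.2) -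
        ∫ ω, ab j ω ∂P) fun j => by fun_prop
  have hmean : ∀ j, ∫ ω, ξ j ω ∂P = 0 := by
    intro j
    have habi : Integrable (ab j) P := by
      have h3 : Integrable (ξ j) P := (hmom j).1.integrable (by
        rw [← ENNReal.ofReal_one]; exact ENNReal.ofReal_le_ofReal (by linarith))
      have := h3.add (integrable_const (∫ ω, ab j ω ∂P))
      refine this.congr (Filter.Eventually.of_forall fun ω => ?_)
      simp [ξ]
    simp only [ξ]
    rw [integral_sub habi (integrable_const _)]
    simp
  set M := (2 * 2 ^ (2 * q) * W) ^ (1 / (2 * q)) with hMdef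
  have hB0 : 0 ≤ 2 * 2 ^ (2 * q) * W := by positivity
  have hM0 : 0 ≤ M := Real.rpow_nonneg hB0 _
  have hMq : M ^ (2 * q) = 2 * 2 ^ (2 * q) * W := by
    rw [hMdef, ← Real.rpow_mul hB0]
    field_simp
    simp
  have hMZ := integral_abs_sum_rpow_le (by linarith : 2 ≤ 2 * q) hM0 hind
    (fun j => (habm j).sub_const _) (fun j => (hmom j).1) hmean
    (fun j => by rw [hMq]; exact (hmom j).2) Finset.univ
  rw [Finset.card_univ, Fintype.card_fin, hMq] at hMZ
  constructor
  · simp_rw [hdev]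
    exact (memLp_finsetSum _ fun j _ => (hmom j).1).const_mul _
  · simp_rw [hdev, abs_mul, Real.mul_rpow (abs_nonneg _) (abs_nonneg _)]
    rw [integral_const_mul]
    have hK := momentConstant_pos (by linarith : 2 ≤ 2 * q)
    calc _ ≤ |1 / (p : ℝ)| ^ (2 * q) *
          ((momentConstant (2 * q) * p) ^ (2 * q / 2) * (2 * 2 ^ (2 * q) * W)) := by gcongr
      _ = _ := by
          have e1 : |1 / (p : ℝ)| ^ (2 * q) = (1 / (p : ℝ) ^ 2) ^ q := by
            rw [abs_of_pos (by positivity), Real.rpow_mul (by positivity)]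
            norm_num
          have e2 : 2 * 2 ^ (2 * q) * W = ((2 * 2 ^ (2 * q) * W) ^ (1 / q)) ^ q := by
            rw [← Real.rpow_mul hB0]; field_simp; simp
          have e3 : 2 * q / 2 = q := by ring
          rw [e1, e3]
          nth_rewrite 1 [e2]
          rw [← Real.mul_rpow (by positivity) (by positivity),
            ← Real.mul_rpow (by positivity) (by positivity), noiseLevel, ← hW]
          congr 1
          field_simp

omit [IsProbabilityMeasure P] in
/-- The fields and the noise are jointly measurable for a σ-algebra `𝓗` on `Ω` which is
independent of the latent variables; the second random variable, `id`, is `Ω` with the σ-algebra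
`𝓗`. -/
theorem IsModel.exists_indep_latent (h : IsModel P μ Z X E) :
    ∃ 𝓗 : MeasurableSpace Ω, 𝓗 ≤ mΩ ∧
      (∀ j, Measurable[MeasurableSpace.prod ‹MeasurableSpace 𝒵› 𝓗]
        (fun a : 𝒵 × Ω => X j a.1 a.2)) ∧ (∀ i j, Measurable[𝓗] (E i j)) ∧
      @IndepFun Ω (Fin n → 𝒵) Ω mΩ _ 𝓗 (fun ω i => Z i ω) id P := by
  have hZle : MeasurableSpace.comap (fun ω i => Z i ω) MeasurableSpace.pi ≤ mΩ :=
    (measurable_pi_lambda _ h.measurable_latent).comap_le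
  have hEle : MeasurableSpace.comap (fun ω i j => E i j ω) MeasurableSpace.pi ≤ mΩ :=
    (measurable_pi_lambda _ fun i => measurable_pi_lambda _ fun j =>
      h.measurable_noise i j).comap_le
  have hEc := measurable_comap_entry (E := E)
  obtain ⟨𝓖, hle, hX, hind⟩ := h.indep_sources
  refine ⟨𝓖 ⊔ MeasurableSpace.comap (fun ω i j => E i j ω) MeasurableSpace.pi,
    sup_le hle hEle, fun j t ht => (sup_le_sup_left
      (MeasurableSpace.comap_mono le_sup_left) _ :
        MeasurableSpace.prod _ 𝓖 ≤ MeasurableSpace.prod _ _) _ (hX j ht),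
    fun i j t ht => le_sup_right (a := 𝓖) _ (hEc i j ht), ?_⟩
  refine (@IndepFun_iff_Indep _ _ _ mΩ _ (𝓖 ⊔ _) _ _ P).2 ?_
  rw [MeasurableSpace.comap_id]
  have hles : ∀ i, ![MeasurableSpace.comap (fun ω i => Z i ω) MeasurableSpace.pi, 𝓖,
      MeasurableSpace.comap (fun ω i j => E i j ω) MeasurableSpace.pi] i ≤ mΩ := by
    intro i
    fin_cases i
    · exact hZle
    · exact hle
    · exact hEle
  have := indep_iSup_of_disjoint hles hind (S := {0}) (T := {1, 2}) (by simp)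
  simpa [iSup_or, iSup_sup_eq] using this

/-- The squared Frobenius norm of the deviation at the random latent positions is of order `n² /
p` in `L^q`. For frozen positions this is the entrywise moment bound and the power mean
inequality; the bound is uniform in the positions, which are independent of fields and noise. -/
theorem IsModel.lintegral_frobenius_le (h : IsModel P μ Z X E) (hn : 0 < n) (hp : 0 < p)
    (hq : 1 ≤ q) (hM : fieldMoment P X (4 * q) < ∞) (hN : noiseMoment P E (4 * q) < ∞)
    (hf : Measurable fun a : 𝒵 × 𝒵 => meanCorrelationKernel P X a.1 a.2) :
    ∫⁻ ω, ENNReal.ofReal ((∑ i, ∑ k, gramDeviation σ (meanCorrelationKernel P X) X E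
      (fun i => Z i ω) ω i k ^ 2) ^ q) ∂P ≤ ENNReal.ofReal ((n ^ 2 * (noiseLevel q
        (fieldMoment P X (4 * q)).toReal (noiseMoment P E (4 * q)).toReal (σ ^ 2) / p)) ^ q) := by
  have hn0 : (0 : ℝ) < n := by exact_mod_cast hn
  set L := noiseLevel q (fieldMoment P X (4 * q)).toReal (noiseMoment P E (4 * q)).toReal (σ ^ 2)
    with hL
  have hL0 : 0 ≤ L := by
    have := momentConstant_pos (by linarith : 2 ≤ 2 * q)
    rw [hL, noiseLevel]; positivity
  set f := meanCorrelationKernel P X with hfdef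
  -- the bound for deterministic latent positions
  have hfix : ∀ z : Fin n → 𝒵, ∫⁻ ω, ENNReal.ofReal ((∑ i, ∑ k,
      gramDeviation σ f X E z ω i k ^ 2) ^ q) ∂P ≤ ENNReal.ofReal ((n ^ 2 * (L / p)) ^ q) := by
    intro z
    set D : Fin n × Fin n → Ω → ℝ := fun a ω => gramDeviation σ f X E z ω a.1 a.2 with hD
    have hmom : ∀ a, MemLp (D a) (ENNReal.ofReal (2 * q)) P ∧
        ∫ ω, |D a ω| ^ (2 * q) ∂P ≤ (L / p) ^ q := fun a =>
      h.gramDeviation_moment hp hq hM hN z a.1 a.2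
    have hint : ∀ a, Integrable (fun ω => |D a ω| ^ (2 * q)) P := fun a =>
      integrable_abs_rpow (by linarith) (hmom a).1
    have hpt : ∀ ω, (∑ i, ∑ k, gramDeviation σ f X E z ω i k ^ 2) ^ q ≤
        ((n : ℝ) ^ 2) ^ (q - 1) * ∑ a, |D a ω| ^ (2 * q) := by
      intro ω
      have h1 := Real.rpow_sum_le_const_mul_sum_rpow_of_nonneg
        (Finset.univ : Finset (Fin n × Fin n))
        (f := fun a => D a ω ^ 2) hq fun a _ => sq_nonneg _
      have h2 : ∀ a, (D a ω ^ 2) ^ q = |D a ω| ^ (2 * q) := fun a => by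
        rw [← sq_abs, ← Real.rpow_natCast, ← Real.rpow_mul (abs_nonneg _)]; norm_num
      simp only [h2, Finset.card_univ, Fintype.card_prod, Fintype.card_fin] at h1
      rw [Fintype.sum_prod_type] at h1
      refine h1.trans (le_of_eq ?_)
      congr 2; push_cast; ring
    have hint2 : Integrable (fun ω => ((n : ℝ) ^ 2) ^ (q - 1) * ∑ a, |D a ω| ^ (2 * q)) P :=
      (integrable_finsetSum _ fun a _ => hint a).const_mul _
    calc _ ≤ ∫⁻ ω, ENNReal.ofReal (((n : ℝ) ^ 2) ^ (q - 1) * ∑ a, |D a ω| ^ (2 * q)) ∂P :=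
          lintegral_mono fun ω => ENNReal.ofReal_le_ofReal (hpt ω)
      _ = ENNReal.ofReal (∫ ω, ((n : ℝ) ^ 2) ^ (q - 1) * ∑ a, |D a ω| ^ (2 * q) ∂P) :=
          (ofReal_integral_eq_lintegral_ofReal hint2 (Filter.Eventually.of_forall fun ω =>
            mul_nonneg (by positivity) (Finset.sum_nonneg fun a _ => by positivity))).symm
      _ ≤ _ := by
          refine ENNReal.ofReal_le_ofReal ?_
          rw [integral_const_mul, integral_finsetSum _ fun a _ => hint a]
          calc _ ≤ ((n : ℝ) ^ 2) ^ (q - 1) * ∑ _a : Fin n × Fin n, (L / p) ^ q := by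
                gcongr with a
                exact (hmom a).2
            _ = _ := by
                rw [Real.rpow_sub_one (by positivity), Real.mul_rpow (by positivity)
                  (by positivity)]
                simp only [Finset.sum_const, Finset.card_univ, Fintype.card_prod, Fintype.card_fin,
                  nsmul_eq_mul]
                push_cast
                field_simp
  have hZm : Measurable fun ω i => Z i ω := measurable_pi_lambda _ h.measurable_latent
  obtain ⟨𝓗, hle, hX, hE, hZW⟩ := h.exists_indep_latent
  have hg : Measurable[@Prod.instMeasurableSpace _ _ _ 𝓗]
      fun a : (Fin n → 𝒵) × Ω => ENNReal.ofReal ((∑ i, ∑ k,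
        gramDeviation σ f X E a.1 a.2 i k ^ 2) ^ q) := by
    have hd := fun i k => @measurable_gramDeviation 𝒵 Ω _ 𝓗 n p σ f X E hf hX hE i k
    exact ENNReal.measurable_ofReal.comp ((Finset.measurable_sum _ fun i _ =>
      Finset.measurable_sum _ fun k _ => (hd i k).pow_const 2).pow_const q)
  exact @lintegral_comp_le_of_indepFun Ω mΩ P _ (Fin n → 𝒵) Ω _ 𝓗 (fun ω i => Z i ω) id
    hZm (measurable_id'' hle) hZW _ hg _ hfix

end Deviation

/-! ### Finite-rank Mercer expansions -/

section Mercer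

variable {𝒵 : Type*} [MeasurableSpace 𝒵] {μ : Measure 𝒵} {f : 𝒵 → 𝒵 → ℝ} {lam : ℕ → ℝ}
  {u : ℕ → 𝒵 → ℝ} {r : ℕ}

theorem IsMercerExpansion.eq_sum (h : IsMercerExpansion μ f lam u) (hr : HasRank lam r)
    (z z' : 𝒵) : f z z' = ∑ k : Fin r, lam k * u k z * u k z' := by
  have h1 : HasSum (fun k => lam k * u k z * u k z')
      (∑ k ∈ Finset.range r, lam k * u k z * u k z') := by
    refine hasSum_sum_of_ne_finset_zero fun k hk => ?_
    rw [hr.2 k (by simpa using hk)]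
    ring
  rw [(h.hasSum z z').unique h1, Finset.sum_range]

theorem IsMercerExpansion.last_le (h : IsMercerExpansion μ f lam u) (k : Fin r) :
    lam (r - 1) ≤ lam k := h.antitone (by omega)

theorem HasRank.last_pos (hr : HasRank lam r) (h1 : 1 ≤ r) : 0 < lam (r - 1) :=
  hr.1 _ (by omega)

theorem IsMercerExpansion.sum_sq_le (h : IsMercerExpansion μ f lam u) (hr : HasRank lam r)
    (h1 : 1 ≤ r) {C : ℝ} {z : 𝒵} (hC : f z z ≤ C) :
    ∑ k : Fin r, u k z ^ 2 ≤ C / lam (r - 1) := by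
  rw [le_div_iff₀ (hr.last_pos h1), Finset.sum_mul]
  refine le_trans ?_ hC
  rw [h.eq_sum hr]
  refine Finset.sum_le_sum fun k _ => ?_
  nlinarith [mul_le_mul_of_nonneg_right (h.last_le k) (sq_nonneg (u k z))]

theorem IsMercerExpansion.abs_mul_le (h : IsMercerExpansion μ f lam u) (hr : HasRank lam r)
    (h1 : 1 ≤ r) {C : ℝ} {z : 𝒵} (hC : f z z ≤ C) (k l : Fin r) :
    |u k z * u l z| ≤ C / lam (r - 1) := by
  have hs : ∀ k : Fin r, u k z ^ 2 ≤ C / lam (r - 1) := fun k =>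
    (Finset.single_le_sum (f := fun k : Fin r => u k z ^ 2) (fun k _ => sq_nonneg _)
      (Finset.mem_univ k)).trans (h.sum_sq_le hr h1 hC)
  rw [abs_mul]
  nlinarith [hs k, hs l, sq_nonneg (|u k z| - |u l z|), sq_abs (u k z), sq_abs (u l z)]

/-- A positive semidefinite kernel is bounded by its values on the diagonal. -/
theorem IsMercerExpansion.abs_le (h : IsMercerExpansion μ f lam u) (hr : HasRank lam r)
    {C : ℝ} (hC : ∀ z, f z z ≤ C) (z z' : 𝒵) : |f z z'| ≤ C := by
  have h1 := h.eq_sum hr z z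
  have h2 := h.eq_sum hr z' z'
  have h3 : |f z z'| ≤ (f z z + f z' z') / 2 := by
    rw [h.eq_sum hr z z', h1, h2, ← Finset.sum_add_distrib, Finset.sum_div]
    refine (Finset.abs_sum_le_sum_abs _ _).trans (Finset.sum_le_sum fun k _ => ?_)
    have hk := h.nonneg k
    rw [mul_assoc, abs_mul, abs_of_nonneg hk, abs_mul]
    nlinarith [mul_nonneg hk (sq_nonneg (|u k z| - |u k z'|)), sq_abs (u k z), sq_abs (u k z')]
  linarith [hC z, hC z']

theorem IsMercerExpansion.integrable_mul (h : IsMercerExpansion μ f lam u) (hr : HasRank lam r)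
    (k l : Fin r) : Integrable (fun z => u k z * u l z) μ :=
  (h.memLp k (hr.1 k k.2)).integrable_mul (h.memLp l (hr.1 l l.2))

/-- The eigenfunctions of a continuous kernel are continuous, because `u k z = (lam k)⁻¹ ∫ f z z'
u k z' dμ`. In particular `u k`, which is only assumed a.e. measurable, is measurable. -/
theorem IsMercerExpansion.continuous_eigenfunction [TopologicalSpace 𝒵] [FirstCountableTopology 𝒵]
    [OpensMeasurableSpace 𝒵] (h : IsMercerExpansion μ f lam u) (hr : HasRank lam r)
    (hf : Continuous fun a : 𝒵 × 𝒵 => f a.1 a.2) {C : ℝ} (hC : ∀ z, f z z ≤ C)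
    [IsFiniteMeasure μ] (k : Fin r) : Continuous (u k) := by
  have hk := hr.1 k k.2
  have heq : ∀ z, u k z = (lam k)⁻¹ * ∫ z', f z z' * u k z' ∂μ := by
    intro z
    have h1 : ∀ z', f z z' * u k z' = ∑ l : Fin r, lam l * u l z * (u l z' * u k z') := by
      intro z'
      rw [h.eq_sum hr, Finset.sum_mul]
      exact Finset.sum_congr rfl fun l _ => by ring
    simp_rw [h1]
    rw [integral_finsetSum _ fun l _ => (h.integrable_mul hr l k).const_mul _]
    simp only [integral_const_mul]
    rw [Finset.sum_eq_single k]
    · rw [h.orthonormal k k hk hk, if_pos rfl]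
      field_simp
    · intro l _ hl
      rw [h.orthonormal l k (hr.1 l l.2) hk, if_neg (by simpa [Fin.val_inj] using hl), mul_zero]
    · simp
  rw [show u k = fun z => (lam k)⁻¹ * ∫ z', f z z' * u k z' ∂μ from funext heq]
  refine continuous_const.mul ?_
  have huk := h.memLp k hk
  refine continuous_of_dominated (bound := fun z' => C * |u k z'|) (fun z => ?_) (fun z => ?_)
    ((huk.integrable one_le_two).abs.const_mul C) ?_
  · have : Continuous fun z' => f z z' := hf.comp (Continuous.prodMk_right z)
    exact this.measurable.aestronglyMeasurable.mul huk.1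
  · refine Filter.Eventually.of_forall fun z' => ?_
    rw [Real.norm_eq_abs, abs_mul]
    exact mul_le_mul_of_nonneg_right (h.abs_le hr hC z z') (abs_nonneg _)
  · refine Filter.Eventually.of_forall fun z' => ?_
    exact (hf.comp (Continuous.prodMk_left z')).mul continuous_const

/-- The rank is at most `C / λᵣ`, for `C` a bound for the kernel on the diagonal: integrate
`∑ k, u k ^ 2 ≤ C / λᵣ`. It is therefore controlled by the kernel and its least positive
eigenvalue. -/
theorem IsMercerExpansion.rank_le [IsProbabilityMeasure μ] (h : IsMercerExpansion μ f lam u)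
    (hr : HasRank lam r) (h1 : 1 ≤ r) {C : ℝ} (hC : ∀ z, f z z ≤ C) :
    (r : ℝ) ≤ C / lam (r - 1) := by
  have hint : ∀ k : Fin r, Integrable (fun z => u k z ^ 2) μ := fun k => by
    simpa [sq] using h.integrable_mul hr k k
  have hone : ∀ k : Fin r, ∫ z, u k z ^ 2 ∂μ = 1 := fun k => by
    simpa [sq] using h.orthonormal k k (hr.1 k k.2) (hr.1 k k.2)
  calc (r : ℝ) = ∫ z, ∑ k : Fin r, u k z ^ 2 ∂μ := by
        rw [integral_finsetSum _ fun k _ => hint k]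
        simp [hone]
    _ ≤ ∫ _z, C / lam (r - 1) ∂μ :=
        integral_mono (integrable_finsetSum _ fun k _ => hint k) (integrable_const _)
          fun z => h.sum_sq_le hr h1 (hC z)
    _ = _ := by simp

end Mercer

/-! ### Lower bound for the Gram matrix of the feature map -/

section GramMatrix

/-- The `n × r` matrix whose rows are the feature vectors `φ(z i)`. -/
def featureMatrix {𝒵 : Type*} {n : ℕ} (lam : ℕ → ℝ) (u : ℕ → 𝒵 → ℝ) (r : ℕ) (z : Fin n → 𝒵) :
    Matrix (Fin n) (Fin r) ℝ :=
  Matrix.of fun i k => featureMap lam u r (z i) k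

/-- A symmetric `r × r` matrix with entries within `N / (2r)` of those of `N • 1` is at least `(N
/ 2) • 1` as a quadratic form. The closeness is encoded by one one-sided bound for each pair `(k,
l)`: a lower bound for `k ≤ l`, an upper bound for `l < k`, and none from above on the diagonal.
This leaves `r²` bounds in all, and thus a single one for `r = 1`. -/
theorem le_quadraticForm_of_entries {r : ℕ} {H : Matrix (Fin r) (Fin r) ℝ} {N : ℝ}
    (hH : ∀ k l, H k l = H l k) (hr : 1 ≤ r)
    (hent : ∀ k l, (if k ≤ l then -1 else 1) * (H k l - if k = l then N else 0) ≤ N / (2 * r))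
    (hN : 0 ≤ N) (y : Fin r → ℝ) : N / 2 * ∑ k, y k ^ 2 ≤ ∑ k, ∑ l, H k l * (y k * y l) := by
  set t := N / (2 * (r : ℝ)) with ht
  have hr0 : (0 : ℝ) < r := by exact_mod_cast hr
  have ht0 : 0 ≤ t := by positivity
  have hpt : ∀ k l, (if k = l then N * (y k * y l) else 0) - t * (|y k| * |y l|) ≤
      H k l * (y k * y l) := by
    intro k l
    rcases lt_trichotomy k l with hkl | rfl | hkl
    · have h1 := hent k l
      have h2 := hent l k
      rw [if_pos hkl.le, if_neg hkl.ne] at h1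
      rw [if_neg (not_le.2 hkl), if_neg hkl.ne', hH l k] at h2
      have h3 : |H k l| ≤ t := abs_le.2 ⟨by linarith, by linarith⟩
      have h4 := neg_abs_le (H k l * (y k * y l))
      rw [abs_mul, abs_mul] at h4
      rw [if_neg hkl.ne]
      nlinarith [mul_le_mul_of_nonneg_right h3 (mul_nonneg (abs_nonneg (y k)) (abs_nonneg (y l)))]
    · have h1 := hent k k
      rw [if_pos le_rfl, if_pos rfl] at h1
      rw [if_pos rfl, abs_mul_abs_self]
      nlinarith [mul_le_mul_of_nonneg_right h1 (mul_self_nonneg (y k))]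
    · have h1 := hent k l
      have h2 := hent l k
      rw [if_neg (not_le.2 hkl), if_neg hkl.ne'] at h1
      rw [if_pos hkl.le, if_neg hkl.ne, hH l k] at h2
      have h3 : |H k l| ≤ t := abs_le.2 ⟨by linarith, by linarith⟩
      have h4 := neg_abs_le (H k l * (y k * y l))
      rw [abs_mul, abs_mul] at h4
      rw [if_neg hkl.ne']
      nlinarith [mul_le_mul_of_nonneg_right h3 (mul_nonneg (abs_nonneg (y k)) (abs_nonneg (y l)))]
  refine le_trans ?_ (Finset.sum_le_sum fun k _ => Finset.sum_le_sum fun l _ => hpt k l)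
  have e1 : ∑ k, ∑ l, ((if k = l then N * (y k * y l) else 0) - t * (|y k| * |y l|)) =
      N * ∑ k, y k ^ 2 - t * (∑ k, |y k|) ^ 2 := by
    simp only [Finset.sum_sub_distrib, Finset.sum_ite_eq, Finset.mem_univ, if_true]
    rw [sq (∑ k, |y k|), Finset.sum_mul_sum, Finset.mul_sum, Finset.mul_sum]
    simp only [Finset.mul_sum, sq]
  have e2 : (∑ k, |y k|) ^ 2 ≤ r * ∑ k, y k ^ 2 := by
    have := sq_sum_le_card_mul_sum_sq (s := (Finset.univ : Finset (Fin r))) (f := fun k => |y k|)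
    simpa using this
  have e3 : t * r = N / 2 := by rw [ht]; field_simp
  rw [e1]
  nlinarith [mul_le_mul_of_nonneg_left e2 ht0]

variable {𝒵 Ω : Type*} [MeasurableSpace 𝒵] [MeasurableSpace Ω] {P : Measure Ω}
  [IsProbabilityMeasure P] {μ : Measure 𝒵} [IsProbabilityMeasure μ] {n : ℕ} {Z : Fin n → Ω → 𝒵}
  {f : 𝒵 → 𝒵 → ℝ} {lam : ℕ → ℝ} {u : ℕ → 𝒵 → ℝ} {r : ℕ}

omit [IsProbabilityMeasure μ] in
/-- Hoeffding's inequality for the empirical mean of a bounded function of the latent variables. -/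
theorem measure_sum_sub_mean_ge_le (hZ : ∀ i, Measurable (Z i)) (hlaw : ∀ i, P.map (Z i) = μ)
    (hind : iIndepFun Z P) {g : 𝒵 → ℝ} (hg : Measurable g) {b t : ℝ} (hb : ∀ z, |g z| ≤ b)
    (ht : 0 ≤ t) :
    P {ω | t ≤ ∑ i, (g (Z i ω) - ∫ z, g z ∂μ)} ≤
      ENNReal.ofReal (Real.exp (-t ^ 2 / (2 * (n * b ^ 2)))) := by
  have hsub : ∀ i, HasSubgaussianMGF (fun ω => g (Z i ω) - ∫ z, g z ∂μ)
      ((‖b - (-b)‖₊ / 2) ^ 2) P := by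
    intro i
    have h1 := hasSubgaussianMGF_of_mem_Icc (μ := P) (X := fun ω => g (Z i ω)) (a := -b) (b := b)
      (hg.comp (hZ i)).aemeasurable
      (Filter.Eventually.of_forall fun ω => abs_le.1 (hb (Z i ω)))
    rwa [show ∫ ω, g (Z i ω) ∂P = ∫ z, g z ∂μ by
      rw [← hlaw i, integral_map (hZ i).aemeasurable hg.aestronglyMeasurable]] at h1
  have hi : iIndepFun (fun i ω => g (Z i ω) - ∫ z, g z ∂μ) P :=
    hind.comp (fun _ z => g z - ∫ z, g z ∂μ) fun _ => hg.sub_const _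
  have h2 := HasSubgaussianMGF.measure_sum_ge_le_of_iIndepFun hi (s := Finset.univ)
    (fun i _ => hsub i) ht
  rw [← ofReal_measureReal]
  refine ENNReal.ofReal_le_ofReal (h2.trans (le_of_eq ?_))
  congr 3
  simp only [Finset.sum_const, Finset.card_univ, Fintype.card_fin, nsmul_eq_mul]
  push_cast
  rw [sub_neg_eq_add, ← two_mul, Real.norm_eq_abs, abs_mul]
  rw [abs_two, mul_div_cancel_left₀ _ (two_ne_zero), sq_abs]

/-- The Gram matrix of the feature vectors is at least `n λᵣ / 2` outside an event of probability
exponentially small in `n`. The prefactor is exactly `r²`, so that for `r = 1` it is `1`: this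
matters when `δ` is close to `1`, see `failureShare`. -/
theorem measure_gram_lower_fail_le (hZ : ∀ i, Measurable (Z i)) (hlaw : ∀ i, P.map (Z i) = μ)
    (hind : iIndepFun Z P) (h : IsMercerExpansion μ f lam u) (hr : HasRank lam r) (h1 : 1 ≤ r)
    (hu : ∀ k : Fin r, Measurable (u k)) {C : ℝ} (hC : ∀ z, f z z ≤ C) :
    P {ω | ¬ ∀ x : Fin r → ℝ, n * lam (r - 1) / 2 * (x ⬝ᵥ x) ≤
      (featureMatrix lam u r (fun i => Z i ω) *ᵥ x) ⬝ᵥ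
        (featureMatrix lam u r (fun i => Z i ω) *ᵥ x)} ≤
      ENNReal.ofReal (r ^ 2 * Real.exp (-n / (8 * (C / lam (r - 1)) ^ 4))) := by
  set b := C / lam (r - 1) with hb
  have hr0 : (1 : ℝ) ≤ r := by exact_mod_cast h1
  have hrb : (r : ℝ) ≤ b := h.rank_le hr h1 hC
  let s : Fin r → Fin r → ℝ := fun k l => if k ≤ l then -1 else 1
  have hs : ∀ k l, |s k l| = 1 := fun k l => by simp only [s]; split_ifs <;> simp
  let g : Fin r → Fin r → 𝒵 → ℝ := fun k l z => s k l * (u k z * u l z)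
  have hgm : ∀ k l, Measurable (g k l) := fun k l => ((hu k).mul (hu l)).const_mul _
  have hgb : ∀ k l z, |g k l z| ≤ b := fun k l z => by
    simp only [g]
    rw [abs_mul, hs, one_mul]
    exact h.abs_mul_le hr h1 (hC z) k l
  have hgi : ∀ k l, ∫ z, g k l z ∂μ = s k l * if k = l then 1 else 0 := fun k l => by
    simp only [g]
    rw [integral_const_mul, h.orthonormal k l (hr.1 k k.2) (hr.1 l l.2)]
    simp only [Fin.val_inj]
  set t : ℝ := n / (2 * r) with ht
  have ht0 : 0 ≤ t := by positivity
  have htail : ∀ k l, P {ω | t ≤ ∑ i, (g k l (Z i ω) - ∫ z, g k l z ∂μ)} ≤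
      ENNReal.ofReal (Real.exp (-n / (8 * b ^ 4))) := by
    intro k l
    refine (measure_sum_sub_mean_ge_le hZ hlaw hind (hgm k l) (hgb k l) ht0).trans ?_
    refine ENNReal.ofReal_le_ofReal (Real.exp_le_exp.2 ?_)
    rcases Nat.eq_zero_or_pos n with hn | hn
    · simp [ht, hn]
    have hn0 : (0 : ℝ) < n := by exact_mod_cast hn
    have hb0 : 0 < b := by linarith
    have e : -t ^ 2 / (2 * (n * b ^ 2)) = -(n / (8 * (r ^ 2 * b ^ 2))) := by
      rw [ht]; field_simp; ring
    rw [e, neg_div]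
    refine neg_le_neg (div_le_div_of_nonneg_left hn0.le (by positivity) ?_)
    have : (r : ℝ) ^ 2 ≤ b ^ 2 := by gcongr
    nlinarith [sq_nonneg b]
  have hsubset : {ω | ¬ ∀ x : Fin r → ℝ, n * lam (r - 1) / 2 * (x ⬝ᵥ x) ≤
      (featureMatrix lam u r (fun i => Z i ω) *ᵥ x) ⬝ᵥ
        (featureMatrix lam u r (fun i => Z i ω) *ᵥ x)} ⊆
      ⋃ k, ⋃ l, {ω | t ≤ ∑ i, (g k l (Z i ω) - ∫ z, g k l z ∂μ)} := by
    intro ω hω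
    by_contra hc
    simp only [Set.mem_iUnion, Set.mem_ofPred_eq, not_exists, not_le] at hc
    refine hω fun x => ?_
    set H : Matrix (Fin r) (Fin r) ℝ := Matrix.of fun k l => ∑ i, u k (Z i ω) * u l (Z i ω) with hH
    have hq := le_quadraticForm_of_entries (H := H) (N := n)
      (fun k l => by simp only [hH, Matrix.of_apply, mul_comm]) h1 (fun k l => by
        refine le_trans (le_of_eq ?_) (hc k l).le
        rw [hgi]
        simp only [g, hH, Matrix.of_apply, Finset.sum_sub_distrib, ← Finset.mul_sum,
          Finset.sum_const, Finset.card_univ, Fintype.card_fin, nsmul_eq_mul]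
        change s k l * _ = _
        split_ifs <;> ring) (Nat.cast_nonneg n) (fun k => √(lam k) * x k)
    have e1 : (featureMatrix lam u r (fun i => Z i ω) *ᵥ x) ⬝ᵥ
        (featureMatrix lam u r (fun i => Z i ω) *ᵥ x) =
        ∑ k : Fin r, ∑ l : Fin r, H k l * ((√(lam k) * x k) * (√(lam l) * x l)) := by
      simp only [featureMatrix, featureMap, Matrix.mulVec, dotProduct, Matrix.of_apply,
        Finset.sum_mul_sum]
      simp only [hH, Matrix.of_apply, Finset.sum_mul]
      rw [Finset.sum_comm]
      refine Finset.sum_congr rfl fun k _ => ?_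
      rw [Finset.sum_comm]
      exact Finset.sum_congr rfl fun l _ => Finset.sum_congr rfl fun i _ => by ring
    rw [e1]
    refine le_trans ?_ hq
    rw [dotProduct, Finset.mul_sum, Finset.mul_sum]
    refine Finset.sum_le_sum fun k _ => ?_
    rw [mul_pow, Real.sq_sqrt (h.nonneg k)]
    have := mul_le_mul_of_nonneg_left (h.last_le k) (mul_nonneg (Nat.cast_nonneg n : (0 : ℝ) ≤ n)
      (sq_nonneg (x k)))
    nlinarith
  calc _ ≤ P (⋃ k, ⋃ l, {ω | t ≤ ∑ i, (g k l (Z i ω) - ∫ z, g k l z ∂μ)}) := measure_mono hsubset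
    _ ≤ ∑ k, ∑ l, P {ω | t ≤ ∑ i, (g k l (Z i ω) - ∫ z, g k l z ∂μ)} :=
        (measure_iUnion_fintype_le _ _).trans
          (Finset.sum_le_sum fun k _ => measure_iUnion_fintype_le _ _)
    _ ≤ ∑ _k : Fin r, ∑ _l : Fin r, ENNReal.ofReal (Real.exp (-n / (8 * b ^ 4))) :=
        Finset.sum_le_sum fun k _ => Finset.sum_le_sum fun l _ => htail k l
    _ = _ := by
        simp only [Finset.sum_const, Finset.card_univ, Fintype.card_fin, nsmul_eq_mul]
        rw [ENNReal.ofReal_mul (by positivity), ENNReal.ofReal_pow (by positivity),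
          ENNReal.ofReal_natCast]
        ring

end GramMatrix

/-! ### Measurable near-minimizers -/

section Selection

/-- A measurable selection of near-minimizers of a random continuous function `G`, among the
points of a countable dense set `d`. The selection depends on the slack `η` only. -/
theorem exists_measurable_near_minimizer {Ω T : Type*} [MeasurableSpace Ω] [TopologicalSpace T]
    [SecondCountableTopology T] [Nonempty T] {G : T → Ω → ℝ} (hc : ∀ ω, Continuous fun t => G t ω)
    (hm : ∀ t, Measurable (G t)) (h0 : ∀ t ω, 0 ≤ G t ω) {η : ℝ} (hη : 0 < η) :
    ∃ (d : ℕ → T) (N : Ω → ℕ), Measurable N ∧ ∀ ω t, G (d (N ω)) ω < G t ω + η := by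
  classical
  let d := TopologicalSpace.denseSeq T
  have hbdd : ∀ ω, BddBelow (Set.range fun j => G (d j) ω) := fun ω =>
    ⟨0, by rintro _ ⟨j, rfl⟩; exact h0 _ _⟩
  have hex : ∀ ω, ∃ k, G (d k) ω < (⨅ j, G (d j) ω) + η := fun ω =>
    exists_lt_of_ciInf_lt (lt_add_of_pos_right _ hη)
  refine ⟨d, fun ω => Nat.find (hex ω), measurable_find hex fun k => ?_, fun ω t => ?_⟩
  · exact measurableSet_lt (hm _) ((Measurable.iInf fun j => hm (d j)).add_const η)
  · refine (Nat.find_spec (hex ω)).trans_le (add_le_add_left ?_ η)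
    have hcl : IsClosed {t | (⨅ j, G (d j) ω) ≤ G t ω} := isClosed_le continuous_const (hc ω)
    have hsub : Set.range d ⊆ {t | (⨅ j, G (d j) ω) ≤ G t ω} := by
      rintro _ ⟨j, rfl⟩
      exact ciInf_le (hbdd ω) j
    exact hcl.closure_subset_iff.2 hsub (TopologicalSpace.denseRange_denseSeq T t)

end Selection

/-! ### Alignment of the normalized scores -/

section Alignment

variable {n p r : ℕ}

theorem bilinear_sq_le_frobenius (Δ : Matrix (Fin n) (Fin n) ℝ) (x y : Fin n → ℝ) :
    (x ⬝ᵥ Δ *ᵥ y) ^ 2 ≤ (∑ i, ∑ k, Δ i k ^ 2) * ((x ⬝ᵥ x) * (y ⬝ᵥ y)) := by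
  have h1 : (Δ *ᵥ y) ⬝ᵥ (Δ *ᵥ y) ≤ (∑ i, ∑ k, Δ i k ^ 2) * (y ⬝ᵥ y) := by
    rw [Finset.sum_mul, dotProduct]
    refine Finset.sum_le_sum fun i _ => ?_
    have := dotProduct_sq_le (Δ i) y
    simpa [sq, dotProduct, Matrix.mulVec] using this
  have h2 := dotProduct_sq_le x (Δ *ᵥ y)
  nlinarith [mul_le_mul_of_nonneg_left h1 (dotProduct_self_nonneg' x)]

/-- The normalized scores `p^{-1/2} Y V`. -/
def scaledScores (Y : Matrix (Fin n) (Fin p) ℝ) (V : Matrix (Fin p) (Fin r) ℝ) :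
    Matrix (Fin n) (Fin r) ℝ :=
  (√(p : ℝ))⁻¹ • (Y * V)

/-- Deterministic core of the theorem: if `p⁻¹ Y Yᵀ = B Bᵀ + s • 1 + Δ` and `B` is well
conditioned, a rotation of the normalized scores is close to `B` in Frobenius norm. -/
theorem exists_orthogonal_alignment {hrp : r ≤ p} (hp : 0 < p)
    {Y : Matrix (Fin n) (Fin p) ℝ} {V : Matrix (Fin p) (Fin r) ℝ} (hV : IsTopEigenvectors hrp Y V)
    {B : Matrix (Fin n) (Fin r) ℝ} {Δ : Matrix (Fin n) (Fin n) ℝ} {s m : ℝ} (hs : 0 ≤ s)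
    (hdec : (1 / (p : ℝ)) • (Y * Yᵀ) = B * Bᵀ + s • 1 + Δ) (hm : 0 < m)
    (hB : ∀ x, m * (x ⬝ᵥ x) ≤ (B *ᵥ x) ⬝ᵥ (B *ᵥ x))
    (hlt : 2 * (s + √(∑ i, ∑ k, Δ i k ^ 2)) < m) :
    ∃ Q ∈ Matrix.orthogonalGroup (Fin r) ℝ,
      ∑ i, ∑ k, ((scaledScores Y V * Qᵀ) i k - B i k) ^ 2 ≤
        r * (4 * (2 * (s + √(∑ i, ∑ k, Δ i k ^ 2))) ^ 2 / m) := by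
  set d := √(∑ i, ∑ k, Δ i k ^ 2) with hd
  have hd0 : 0 ≤ d := Real.sqrt_nonneg _
  have hd2 : d ^ 2 = ∑ i, ∑ k, Δ i k ^ 2 :=
    Real.sq_sqrt (Finset.sum_nonneg fun i _ => Finset.sum_nonneg fun k _ => sq_nonneg _)
  obtain ⟨Λ, hΛ, hdom⟩ := hV.exists_eigenvalues
  have hp0 : (0 : ℝ) < p := by exact_mod_cast hp
  set c := (√(p : ℝ))⁻¹ with hc
  have hcc : c * c = 1 / (p : ℝ) := by
    rw [hc, ← mul_inv, Real.mul_self_sqrt hp0.le, one_div]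
  have hscal : scaledScores Y V = (c • Y) * V := by rw [scaledScores, Matrix.smul_mul]
  rw [hscal]
  refine exists_orthogonal_frobenius_sq_le hm hB (by positivity) hlt ?_
  refine bilinear_sq_le (Δ := Δ) (Λ := fun k => c * c * Λ k) hV.1 ?_ ?_ ?_ hs hd0 ?_
  · have e : (c • Y)ᵀ * (c • Y) = (c * c) • (Yᵀ * Y) := by
      rw [Matrix.transpose_smul, Matrix.smul_mul, Matrix.mul_smul, smul_smul]
    rw [e, Matrix.smul_mul, hΛ, ← Matrix.mul_smul]
    congr 1
    ext i k
    by_cases hik : i = k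
    · subst hik; simp
    · simp [hik]
  · intro x hx k
    rw [Matrix.smul_mulVec, smul_dotProduct, dotProduct_smul, smul_smul, smul_eq_mul,
      mul_assoc (c * c)]
    exact mul_le_mul_of_nonneg_left (hdom x hx k) (mul_self_nonneg c)
  · rw [← hdec, Matrix.transpose_smul, Matrix.smul_mul, Matrix.mul_smul, smul_smul, hcc]
  · intro x y
    rw [hd2]
    exact bilinear_sq_le_frobenius Δ x y

end Alignment

/-! ### The constants -/

section Constants

/-- The constant in the lower bound for the number `n` of latent variables; `b` stands for the least
positive eigenvalue. The summand `1` and the absolute value make it positive for every `b`. -/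
def latentConstant {𝒵 : Type*} (f : 𝒵 → 𝒵 → ℝ) (b : ℝ) : ℝ :=
  1 + |512 / b| + 32 * ((sSup (Set.range fun z => f z z)) / b) ^ 4

/-- The share `κ` of the failure probability `δ` which is allotted to the deviation
`gramDeviation`. When the bound on `n` holds, the failure probability of the Gram matrix bound is
at most `exp (-1 / (16 b⁴)) δ` for `b = sup f / λᵣ`, with the supremum over the diagonal, and `sup
f ≤ M ^ (1 / (2 q))`; this leaves `κ δ`. A fixed split, such as into halves, is not available: for
`r = 1` and `δ` close to `1` the term `log (r / δ)` vanishes and does not force `n` to be large.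
-/
def failureShare (M q b : ℝ) : ℝ := 1 - Real.exp (-(1 / (16 * (M ^ (1 / (2 * q)) / b) ^ 4)))

/-- The constant in the lower bound for `p / n`; `b` stands for the least positive eigenvalue, and
`M`, `N`, `s` for the two moments and the noise variance. The summand `1` and the absolute values
make it at least `1` for all arguments. -/
def fieldConstant (q b M N s : ℝ) : ℝ :=
  1 + |512 * (noiseLevel q M N s + 1) / failureShare M q b ^ (1 / q) / b| +
    |512 * (noiseLevel q M N s + 1) / failureShare M q b ^ (1 / q) / b ^ 2|

theorem latentConstant_pos {𝒵 : Type*} (f : 𝒵 → 𝒵 → ℝ) (b : ℝ) : 0 < latentConstant f b := by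
  unfold latentConstant; positivity

theorem fieldConstant_pos (q b M N s : ℝ) : 0 < fieldConstant q b M N s := by
  unfold fieldConstant; positivity

/-- Half of the exponent `n / (8 b⁴)` is spent on the prefactor `r²` and on `δ`, and the other half,
where `n ≥ 1` is used, on the factor that leaves room for the second exceptional event. -/
theorem gram_tail_le {b δ n r : ℝ} (hr : 1 ≤ r) (hb : 0 < b) (hδ : 0 < δ) (hδ1 : δ < 1)
    (hn : 1 ≤ n) (hnlog : 32 * b ^ 4 * Real.log (r / δ) ≤ n) :
    r ^ 2 * Real.exp (-n / (8 * b ^ 4)) ≤ Real.exp (-(1 / (16 * b ^ 4))) * δ := by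
  have hr0 : 0 < r := by linarith
  have h1 : -n / (8 * b ^ 4) ≤ -(1 / (16 * b ^ 4)) + -(2 * Real.log (r / δ)) := by
    have e1 : -n / (8 * b ^ 4) = -(n / (16 * b ^ 4)) + -(n / (16 * b ^ 4)) := by
      field_simp; ring
    rw [e1]
    refine add_le_add (neg_le_neg ?_) (neg_le_neg ?_)
    · gcongr
    · rw [le_div_iff₀ (by positivity)]; nlinarith
  have h2 : Real.exp (-(2 * Real.log (r / δ))) = (δ / r) ^ 2 := by
    rw [Real.exp_neg, mul_comm, Real.exp_mul, Real.exp_log (by positivity)]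
    rw [Real.rpow_two, div_pow, inv_div, div_pow]
  calc r ^ 2 * Real.exp (-n / (8 * b ^ 4))
      ≤ r ^ 2 * (Real.exp (-(1 / (16 * b ^ 4))) * (δ / r) ^ 2) := by
        rw [← h2, ← Real.exp_add]
        gcongr
    _ = Real.exp (-(1 / (16 * b ^ 4))) * δ ^ 2 := by field_simp
    _ ≤ _ := by
        refine mul_le_mul_of_nonneg_left ?_ (Real.exp_pos _).le
        nlinarith

theorem noiseLevel_nonneg {q M N s : ℝ} (hq : 1 ≤ q) (hM : 0 ≤ M) (hN : 0 ≤ N) (hs : 0 ≤ s) :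
    0 ≤ noiseLevel q M N s := by
  have := momentConstant_pos (by linarith : 2 ≤ 2 * q)
  rw [noiseLevel]; positivity

theorem latentConstant_spec {𝒵 : Type*} {f : 𝒵 → 𝒵 → ℝ} {n r l s δ ε : ℝ} (hr : 1 ≤ r)
    (hδ : 0 < δ) (hδ1 : δ < 1) (hε : 0 < ε) (hl : 0 < l)
    (hb : 0 < sSup (Set.range fun z => f z z) / l) (hs : 0 ≤ s)
    (hn : n ≥ latentConstant f l * max (s * √r * max 1 (s * √r / ε ^ 2)) (Real.log (r / δ))) :
    32 * (sSup (Set.range fun z => f z z) / l) ^ 4 * Real.log (r / δ) ≤ n ∧ 512 * s ≤ n * l ∧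
      512 * (r * s ^ 2) ≤ n * l * ε ^ 2 := by
  have hr0 : 0 < r := by linarith
  set b := sSup (Set.range fun z => f z z) / l with hbdef
  have hb4 : 0 ≤ 32 * b ^ 4 := by positivity
  have hcl : latentConstant f l = 1 + |512 / l| + 32 * b ^ 4 := rfl
  have hc1 : 512 / l ≤ latentConstant f l := by linarith [le_abs_self (512 / l)]
  have hc2 : 32 * b ^ 4 ≤ latentConstant f l := by linarith [abs_nonneg (512 / l)]
  have hc0 := latentConstant_pos f l
  have hsr : 1 ≤ √r := Real.one_le_sqrt.2 hr
  refine ⟨?_, ?_, ?_⟩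
  · have h1 : 0 ≤ Real.log (r / δ) := Real.log_nonneg (by rw [le_div_iff₀ hδ]; linarith)
    exact (mul_le_mul hc2 (le_max_right _ _) h1 hc0.le).trans hn
  · have h1 : 512 / l * s ≤ n := by
      refine le_trans (mul_le_mul hc1 ?_ hs hc0.le) hn
      refine le_trans ?_ (le_max_left _ _)
      calc s = s * 1 * 1 := by ring
        _ ≤ _ := mul_le_mul (mul_le_mul_of_nonneg_left hsr hs) (le_max_left _ _) zero_le_one
          (by positivity)
    rwa [div_mul_eq_mul_div, div_le_iff₀ hl] at h1
  · have h1 : 512 / l * (r * s ^ 2 / ε ^ 2) ≤ n := by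
      refine le_trans (mul_le_mul hc1 ?_ (by positivity) hc0.le) hn
      refine le_trans ?_ (le_max_left _ _)
      calc r * s ^ 2 / ε ^ 2 = s * √r * (s * √r / ε ^ 2) := by
            nth_rewrite 1 [← Real.mul_self_sqrt hr0.le]
            ring
        _ ≤ _ := mul_le_mul_of_nonneg_left (le_max_right _ _) (by positivity)
    rw [div_mul_div_comm, div_le_iff₀ (by positivity)] at h1
    linarith

theorem fieldConstant_spec {n p r l s δ ε q M N : ℝ} (hr : 1 ≤ r) (hn : 0 < n) (hp : 0 < p)
    (hδ : 0 < δ) (hε : 0 < ε) (hε1 : ε ≤ 1) (hl : 0 < l) (hκ : 0 < failureShare M q l)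
    (hL : 0 ≤ noiseLevel q M N s)
    (hpn : p / n ≥ fieldConstant q l M N s * (r / (δ ^ (1 / q) * ε ^ 2))) :
    512 * (r * (n ^ 2 * ((noiseLevel q M N s + 1) / p) / (failureShare M q l * δ) ^ (1 / q))) ≤
      n * l * ε ^ 2 ∧
    512 * (n ^ 2 * ((noiseLevel q M N s + 1) / p) / (failureShare M q l * δ) ^ (1 / q)) ≤
      n * l ^ 2 := by
  have hr0 : 0 < r := by linarith
  set κ := failureShare M q l with hκdef
  set L := noiseLevel q M N s with hLdef
  have hκq : 0 < κ ^ (1 / q) := Real.rpow_pos_of_pos hκ _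
  have hδq : 0 < δ ^ (1 / q) := Real.rpow_pos_of_pos hδ _
  set A := (L + 1) / κ ^ (1 / q) with hA
  have hA0 : 0 < A := by positivity
  have hcl : fieldConstant q l M N s = 1 + |512 * A / l| + |512 * A / l ^ 2| := by
    rw [hA, ← mul_div_assoc]; rfl
  have hC1 : 512 * A / l ≤ fieldConstant q l M N s := by
    linarith [le_abs_self (512 * A / l), abs_nonneg (512 * A / l ^ 2)]
  have hC2 : 512 * A / l ^ 2 ≤ fieldConstant q l M N s := by
    linarith [le_abs_self (512 * A / l ^ 2), abs_nonneg (512 * A / l)]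
  have hTA : n ^ 2 * ((L + 1) / p) / (κ * δ) ^ (1 / q) = n * (n * A) / (p * δ ^ (1 / q)) := by
    rw [hA, Real.mul_rpow hκ.le hδ.le]; field_simp
  have hratio : ∀ c, c ≤ fieldConstant q l M N s → c * r * n ≤ p * (δ ^ (1 / q) * ε ^ 2) := by
    intro c hc
    have h1 : c * (r / (δ ^ (1 / q) * ε ^ 2)) ≤ p / n :=
      (mul_le_mul_of_nonneg_right hc (by positivity)).trans hpn
    rwa [← mul_div_assoc, div_le_div_iff₀ (by positivity) hn] at h1
  rw [hTA]
  constructor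
  · have h1 := hratio _ hC1
    rw [div_mul_eq_mul_div, div_mul_eq_mul_div, div_le_iff₀ hl] at h1
    rw [← mul_div_assoc, ← mul_div_assoc, div_le_iff₀ (by positivity)]
    linarith [mul_le_mul_of_nonneg_left h1 hn.le]
  · have h1 := hratio _ hC2
    rw [div_mul_eq_mul_div, div_mul_eq_mul_div, div_le_iff₀ (by positivity)] at h1
    rw [← mul_div_assoc, div_le_iff₀ (by positivity)]
    have h2 : 512 * A * n ≤ 512 * A * r * n := by
      have : 512 * A * 1 ≤ 512 * A * r := mul_le_mul_of_nonneg_left hr (by positivity)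
      nlinarith
    have h3 : p * (δ ^ (1 / q) * ε ^ 2) * l ^ 2 ≤ p * (δ ^ (1 / q) * 1) * l ^ 2 := by
      have h4 : ε ^ 2 ≤ 1 := pow_le_one₀ hε.le hε1
      gcongr
    linarith [mul_le_mul_of_nonneg_left (h2.trans (h1.trans h3)) hn.le]

end Constants

/-! ### Tail of the deviation of the data Gram matrix -/

section DeviationTail

variable {𝒵 Ω : Type*} [MeasurableSpace 𝒵] [MeasurableSpace Ω] {P : Measure Ω}
  [IsProbabilityMeasure P] {μ : Measure 𝒵} {n p : ℕ} {Z : Fin n → Ω → 𝒵} {X : Fin p → 𝒵 → Ω → ℝ}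
  {E : Fin n → Fin p → Ω → ℝ} {σ q : ℝ}

omit [IsProbabilityMeasure P] in
theorem IsModel.measurable_field_joint (h : IsModel P μ Z X E) (j : Fin p) :
    Measurable fun a : 𝒵 × Ω => X j a.1 a.2 := by
  obtain ⟨𝓖, hle, hX, -⟩ := h.indep_sources
  exact (hX j).mono (sup_le_sup_left (MeasurableSpace.comap_mono hle) _) le_rfl

omit [IsProbabilityMeasure P] in
theorem IsModel.measurable_gramDeviation_latent (h : IsModel P μ Z X E) {f : 𝒵 → 𝒵 → ℝ}
    (hf : Measurable fun a : 𝒵 × 𝒵 => f a.1 a.2) (i k : Fin n) :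
    Measurable fun ω => gramDeviation σ f X E (fun i => Z i ω) ω i k := by
  have h1 := measurable_gramDeviation (σ := σ) hf h.measurable_field_joint h.measurable_noise i k
  have h2 : Measurable fun ω => ((fun i => Z i ω), ω) :=
    (measurable_pi_lambda _ h.measurable_latent).prodMk measurable_id
  exact (show Measurable ((fun a : (Fin n → 𝒵) × Ω => gramDeviation σ f X E a.1 a.2 i k) ∘
    fun ω => ((fun i => Z i ω), ω)) from h1.comp h2)

omit [IsProbabilityMeasure P] in
theorem IsModel.measurable_dataMatrix (h : IsModel P μ Z X E) (i : Fin n) (j : Fin p) :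
    Measurable fun ω => dataMatrix σ Z X E ω i j := by
  have h1 : Measurable fun ω => X j (Z i ω) ω :=
    (h.measurable_field_joint j).comp ((h.measurable_latent i).prodMk measurable_id)
  exact h1.add ((h.measurable_noise i j).const_mul σ)

theorem IsModel.meanCorrelationKernel_diag_le (h : IsModel P μ Z X E)
    (hp : 0 < p) (hq : 1 ≤ q) (hM : fieldMoment P X (4 * q) < ∞) (z : 𝒵) :
    meanCorrelationKernel P X z z ≤ (fieldMoment P X (4 * q)).toReal ^ (1 / (2 * q)) := by
  have hj : ∀ j, ∫ ω, X j z ω * X j z ω ∂P ≤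
      (fieldMoment P X (4 * q)).toReal ^ (1 / (2 * q)) := by
    intro j
    have hX := integrable_abs_rpow_of_lintegral (h.measurable_field j z) (by linarith : 0 ≤ 4 * q)
      hM (le_iSup₂_of_le (f := fun j z => ∫⁻ ω, ‖X j z ω‖ₑ ^ (4 * q) ∂P) j z le_rfl)
    have h1 := integral_abs_rpow_le (by norm_num : (0 : ℝ) ≤ 2) (by linarith : 2 ≤ 4 * q)
      (by linarith) (memLp_of_integrable_abs_rpow (by linarith) (h.measurable_field j z) hX.1)
    simp only [Real.rpow_two, sq_abs] at h1
    simp only [← sq]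
    refine h1.trans ?_
    rw [show 2 / (4 * q) = 1 / (2 * q) by field_simp; norm_num]
    exact Real.rpow_le_rpow (integral_nonneg fun ω => Real.rpow_nonneg (abs_nonneg _) _) hX.2
      (by positivity)
  have hp0 : (0 : ℝ) < p := by exact_mod_cast hp
  calc meanCorrelationKernel P X z z
      ≤ (1 / (p : ℝ)) * ∑ _j : Fin p, (fieldMoment P X (4 * q)).toReal ^ (1 / (2 * q)) := by
        unfold meanCorrelationKernel
        gcongr with j
        exact hj j
    _ = _ := by
        simp only [Finset.sum_const, Finset.card_univ, Fintype.card_fin, nsmul_eq_mul]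
        field_simp

/-- Markov's inequality for the squared Frobenius norm of the deviation. The threshold has
`noiseLevel + 1` instead of `noiseLevel` so that it is positive. -/
theorem IsModel.measure_deviation_le (h : IsModel P μ Z X E) (hn : 0 < n) (hp : 0 < p)
    (hq : 1 ≤ q) (hM : fieldMoment P X (4 * q) < ∞) (hN : noiseMoment P E (4 * q) < ∞)
    (hf : Measurable fun a : 𝒵 × 𝒵 => meanCorrelationKernel P X a.1 a.2)
    {δ : ℝ} (hδ : 0 < δ) {T : ℝ}
    (hT : n ^ 2 * ((noiseLevel q (fieldMoment P X (4 * q)).toReal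
      (noiseMoment P E (4 * q)).toReal (σ ^ 2) + 1) / p) / δ ^ (1 / q) ≤ T) :
    P {ω | T < ∑ i, ∑ k, gramDeviation σ (meanCorrelationKernel P X) X E
      (fun i => Z i ω) ω i k ^ 2} ≤ ENNReal.ofReal δ := by
  have hE := h.lintegral_frobenius_le (σ := σ) hn hp hq hM hN hf
  set L := noiseLevel q (fieldMoment P X (4 * q)).toReal (noiseMoment P E (4 * q)).toReal (σ ^ 2)
    with hL
  have hq0 : 0 < q := by linarith
  have hL0 : 0 ≤ L := by
    have := momentConstant_pos (by linarith : 2 ≤ 2 * q)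
    rw [hL, noiseLevel]; positivity
  have hn0 : (0 : ℝ) < n := by exact_mod_cast hn
  have hp0 : (0 : ℝ) < p := by exact_mod_cast hp
  set T₀ := n ^ 2 * ((L + 1) / p) / δ ^ (1 / q) with hT₀
  have hδq : 0 < δ ^ (1 / q) := Real.rpow_pos_of_pos hδ _
  have hT₀pos : 0 < T₀ := by positivity
  have hT₀q : (n ^ 2 * (L / p)) ^ q ≤ T₀ ^ q * δ := by
    have e : T₀ ^ q * δ = (n ^ 2 * ((L + 1) / p)) ^ q := by
      rw [hT₀, Real.div_rpow (by positivity) hδq.le, ← Real.rpow_mul hδ.le,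
        one_div_mul_cancel hq0.ne', Real.rpow_one]
      field_simp
    rw [e]
    gcongr
    linarith
  have hTq : 0 < T₀ ^ q := Real.rpow_pos_of_pos hT₀pos _
  set F : Ω → ℝ := fun ω => ∑ i, ∑ k, gramDeviation σ (meanCorrelationKernel P X) X E
      (fun i => Z i ω) ω i k ^ 2 with hF
  have hFm : Measurable F := Finset.measurable_sum _ fun i _ => Finset.measurable_sum _ fun k _ =>
    (h.measurable_gramDeviation_latent hf i k).pow_const 2
  have hmk := mul_meas_ge_le_lintegral (μ := P)
    (ENNReal.measurable_ofReal.comp (hFm.pow_const q)) (ENNReal.ofReal (T₀ ^ q))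
  refine (measure_mono (t := {ω | ENNReal.ofReal (T₀ ^ q) ≤ ENNReal.ofReal (F ω ^ q)})
    fun ω hω => ?_).trans ?_
  · exact ENNReal.ofReal_le_ofReal (Real.rpow_le_rpow hT₀pos.le (hT.trans (le_of_lt hω)) hq0.le)
  · have h1 := (hmk.trans hE).trans (ENNReal.ofReal_le_ofReal hT₀q)
    rw [ENNReal.ofReal_mul hTq.le] at h1
    exact (ENNReal.mul_le_mul_iff_right (by simpa using hTq) ENNReal.ofReal_ne_top).1 h1

omit [MeasurableSpace Ω] in
theorem dataMatrix_mul_transpose {f : 𝒵 → 𝒵 → ℝ} {lam : ℕ → ℝ} {u : ℕ → 𝒵 → ℝ} {r : ℕ}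
    (hu : IsMercerExpansion μ f lam u) (hr : HasRank lam r) (ω : Ω) :
    (1 / (p : ℝ)) • (dataMatrix σ Z X E ω * (dataMatrix σ Z X E ω)ᵀ) =
      featureMatrix lam u r (fun i => Z i ω) * (featureMatrix lam u r (fun i => Z i ω))ᵀ +
        σ ^ 2 • 1 + gramDeviation σ f X E (fun i => Z i ω) ω := by
  ext i k
  have h1 : (featureMatrix lam u r (fun i => Z i ω) *
      (featureMatrix lam u r (fun i => Z i ω))ᵀ) i k = f (Z i ω) (Z k ω) := by
    rw [hu.eq_sum hr, Matrix.mul_apply]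
    refine Finset.sum_congr rfl fun l _ => ?_
    simp only [featureMatrix, featureMap, Matrix.transpose_apply, Matrix.of_apply]
    rw [mul_assoc, ← Real.mul_self_sqrt (hu.nonneg l), Real.sqrt_mul_self (Real.sqrt_nonneg _)]
    ring
  rw [Matrix.add_apply, Matrix.add_apply, h1]
  simp only [gramDeviation, dataMatrix, Matrix.smul_apply, Matrix.mul_apply, Matrix.of_apply,
    Matrix.transpose_apply, smul_eq_mul, Matrix.one_apply, mul_ite, mul_one, mul_zero]
  ring

end DeviationTail

/-! ### Alignment with high probability -/

section Conclusion

/-- Outside the two exceptional events, the conditions on `n` and `p` give alignment up to `ε /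
2`. -/
theorem exists_orthogonal_le_of_good {n p r : ℕ} {hrp : r ≤ p} (hr : 1 ≤ r) (hn : 1 ≤ n)
    {Y : Matrix (Fin n) (Fin p) ℝ} {V : Matrix (Fin p) (Fin r) ℝ} (hV : IsTopEigenvectors hrp Y V)
    {B : Matrix (Fin n) (Fin r) ℝ} {Δ : Matrix (Fin n) (Fin n) ℝ} {s l ε : ℝ} (hs : 0 ≤ s)
    (hl : 0 < l) (hdec : (1 / (p : ℝ)) • (Y * Yᵀ) = B * Bᵀ + s • 1 + Δ)
    (hB : ∀ x, n * l / 2 * (x ⬝ᵥ x) ≤ (B *ᵥ x) ⬝ᵥ (B *ᵥ x))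
    (hs1 : 512 * s ≤ n * l) (hs2 : 512 * (r * s ^ 2) ≤ n * l * ε ^ 2)
    (hΔ1 : 512 * (r * ∑ i, ∑ k, Δ i k ^ 2) ≤ n * l * ε ^ 2)
    (hΔ2 : 512 * ∑ i, ∑ k, Δ i k ^ 2 ≤ n * l ^ 2) :
    ∃ Q ∈ Matrix.orthogonalGroup (Fin r) ℝ,
      ∑ i, ∑ k, ((scaledScores Y V * Qᵀ) i k - B i k) ^ 2 ≤ (ε / 2) ^ 2 := by
  have hn1 : (1 : ℝ) ≤ n := by exact_mod_cast hn
  set F := ∑ i, ∑ k, Δ i k ^ 2 with hF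
  have hF0 : 0 ≤ F := Finset.sum_nonneg fun i _ => Finset.sum_nonneg fun k _ => sq_nonneg _
  have hd0 : 0 ≤ √F := Real.sqrt_nonneg _
  have hd2 : √F ^ 2 = F := Real.sq_sqrt hF0
  have hnl : 0 < n * l := by positivity
  have hd : √F ≤ n * l / 22 := by
    refine le_of_sq_le_sq ?_ (by positivity)
    rw [hd2]
    have : n * l ^ 2 ≤ (n * l) ^ 2 := by
      rw [mul_pow]
      exact mul_le_mul_of_nonneg_right (by nlinarith) (sq_nonneg l)
    nlinarith
  obtain ⟨Q, hQ, hb⟩ := exists_orthogonal_alignment (by omega) hV hs hdec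
    (by positivity : 0 < n * l / 2) hB (by rw [← hF]; linarith)
  refine ⟨Q, hQ, hb.trans ?_⟩
  rw [← hF, ← mul_div_assoc, div_le_iff₀ (by positivity)]
  have h1 : (s + √F) ^ 2 ≤ 2 * (s ^ 2 + F) := by nlinarith [sq_nonneg (s - √F)]
  have hr0 : (0 : ℝ) ≤ r := Nat.cast_nonneg r
  nlinarith [mul_le_mul_of_nonneg_left h1 hr0]

variable {𝒵 Ω : Type*} [MeasurableSpace 𝒵] [MeasurableSpace Ω] {P : Measure Ω}
  [IsProbabilityMeasure P] {μ : Measure 𝒵} [IsProbabilityMeasure μ] {n p r : ℕ} {hrp : r ≤ p}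
  {Z : Fin n → Ω → 𝒵} {X : Fin p → 𝒵 → Ω → ℝ} {E : Fin n → Fin p → Ω → ℝ} {σ q δ ε : ℝ}
  {lam : ℕ → ℝ} {u : ℕ → 𝒵 → ℝ} {V : Ω → Matrix (Fin p) (Fin r) ℝ}

/-- The probability that no rotation aligns the scores with the feature vectors up to `ε / 2` is at
most `δ`. The set need not be measurable; `P` stands for the outer measure on it. -/
theorem IsModel.measure_no_alignment_le (h : IsModel P μ Z X E) (hr1 : 1 ≤ r) (hn : 1 ≤ n)
    (hq : 1 ≤ q) (hM : fieldMoment P X (4 * q) < ∞) (hN : noiseMoment P E (4 * q) < ∞)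
    (hf : Measurable fun a : 𝒵 × 𝒵 => meanCorrelationKernel P X a.1 a.2)
    (hu : IsMercerExpansion μ (meanCorrelationKernel P X) lam u) (hr : HasRank lam r)
    (hum : ∀ k : Fin r, Measurable (u k))
    (hV : ∀ ω, IsTopEigenvectors hrp (dataMatrix σ Z X E ω) (V ω))
    (hδ : 0 < δ) (hδ1 : δ < 1) (hε : 0 < ε) (hε1 : ε ≤ 1)
    (hnc : (n : ℝ) ≥ latentConstant (meanCorrelationKernel P X) (lam (r - 1)) *
      max (σ ^ 2 * √r * max 1 (σ ^ 2 * √r / ε ^ 2)) (Real.log (r / δ)))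
    (hpc : (p : ℝ) / n ≥ fieldConstant q (lam (r - 1)) (fieldMoment P X (4 * q)).toReal
      (noiseMoment P E (4 * q)).toReal (σ ^ 2) * (r / (δ ^ (1 / q) * ε ^ 2))) :
    P {ω | ¬ ∃ Q ∈ Matrix.orthogonalGroup (Fin r) ℝ, ∑ i, ∑ k,
      ((scaledScores (dataMatrix σ Z X E ω) (V ω) * Qᵀ) i k -
        featureMatrix lam u r (fun i => Z i ω) i k) ^ 2 ≤ (ε / 2) ^ 2} ≤ ENNReal.ofReal δ := by
  set f := meanCorrelationKernel P X with hfdef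
  set M := (fieldMoment P X (4 * q)).toReal with hMdef
  set N := (noiseMoment P E (4 * q)).toReal with hNdef
  set l := lam (r - 1) with hl
  have hl0 : 0 < l := hr.last_pos hr1
  have hp : 0 < p := by omega
  have hn1 : (1 : ℝ) ≤ n := by exact_mod_cast hn
  have hr1' : (1 : ℝ) ≤ r := by exact_mod_cast hr1
  have hp0 : (0 : ℝ) < p := by exact_mod_cast hp
  have hn0 : (0 : ℝ) < n := by linarith
  have hr0 : (0 : ℝ) < r := by linarith
  have hq0 : 0 < q := by linarith
  -- the supremum of the kernel on the diagonal
  obtain ⟨ω₀⟩ : Nonempty Ω := nonempty_of_isProbabilityMeasure P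
  have : Nonempty 𝒵 := ⟨Z ⟨0, by omega⟩ ω₀⟩
  have hdiag : ∀ z, f z z ≤ M ^ (1 / (2 * q)) := h.meanCorrelationKernel_diag_le hp hq hM
  set S := sSup (Set.range fun z => f z z) with hS
  have hSle : ∀ z, f z z ≤ S := fun z =>
    le_csSup ⟨M ^ (1 / (2 * q)), by rintro _ ⟨z, rfl⟩; exact hdiag z⟩ ⟨z, rfl⟩
  have hSM : S ≤ M ^ (1 / (2 * q)) :=
    csSup_le (Set.range_nonempty _) (by rintro _ ⟨z, rfl⟩; exact hdiag z)
  set b := S / l with hb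
  have hrb : (r : ℝ) ≤ b := hu.rank_le hr hr1 hSle
  have hb0 : 0 < b := by linarith
  set b' := M ^ (1 / (2 * q)) / l with hb'
  have hbb' : b ≤ b' := by rw [hb, hb']; gcongr
  have hb'0 : 0 < b' := by linarith
  set κ := failureShare M q l with hκ
  have hκ' : κ = 1 - Real.exp (-(1 / (16 * b' ^ 4))) := rfl
  have hκ0 : 0 < κ := by
    rw [hκ', sub_pos, Real.exp_lt_one_iff, neg_lt_zero]; positivity
  obtain ⟨hlog, hs1, hs2⟩ := latentConstant_spec hr1' hδ hδ1 hε hl0 hb0 (sq_nonneg σ) hnc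
  have hL0 : 0 ≤ noiseLevel q M N (σ ^ 2) :=
    noiseLevel_nonneg hq ENNReal.toReal_nonneg ENNReal.toReal_nonneg (sq_nonneg σ)
  obtain ⟨hT1, hT2⟩ := fieldConstant_spec hr1' hn0 hp0 hδ hε hε1 hl0 hκ0 hL0 hpc
  set T := n ^ 2 * ((noiseLevel q M N (σ ^ 2) + 1) / p) / (κ * δ) ^ (1 / q) with hT
  -- the two exceptional events
  have hgram := measure_gram_lower_fail_le h.measurable_latent h.law_latent h.indep_latent hu hr hr1
    hum hSle
  have hdev := h.measure_deviation_le (σ := σ) hn hp hq hM hN hf (mul_pos hκ0 hδ) (T := T) le_rfl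
  have htail : (r : ℝ) ^ 2 * Real.exp (-n / (8 * b ^ 4)) + κ * δ ≤ δ := by
    have h1 := gram_tail_le hr1' hb0 hδ hδ1 hn1 hlog
    have h2 : Real.exp (-(1 / (16 * b ^ 4))) ≤ 1 - κ := by
      rw [hκ', sub_sub_cancel]
      refine Real.exp_le_exp.2 (neg_le_neg ?_)
      gcongr
    nlinarith
  refine le_trans ?_ (ENNReal.ofReal_le_ofReal htail)
  rw [ENNReal.ofReal_add (by positivity) (by positivity)]
  refine le_trans ?_ (add_le_add hgram hdev)
  refine (measure_mono fun ω hω => ?_).trans (measure_union_le _ _)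
  by_contra hc
  simp only [Set.mem_union, Set.mem_ofPred_eq, not_or, not_not, not_lt] at hc
  refine hω (exists_orthogonal_le_of_good hr1 hn (hV ω) (sq_nonneg σ) hl0
    (dataMatrix_mul_transpose hu hr ω) hc.1 hs1 hs2 ?_ ?_)
  · refine le_trans ?_ hT1
    have := hc.2
    gcongr
  · exact (mul_le_mul_of_nonneg_left hc.2 (by norm_num)).trans hT2

/-- The condition on `p / n` alone forces `ε ≥ p^(-1/2)`. A slack of order `p^(-1/2)` in the
choice of the rotation is therefore harmless, although `ε` is not known when the rotation is
chosen. -/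
theorem inv_sqrt_le_of_fieldConstant {p n : ℕ} {r δ ε q b M N s : ℝ} (hr : 1 ≤ r) (hn : 1 ≤ n)
    (hp : 0 < p) (hq : 1 ≤ q) (hδ : 0 < δ) (hδ1 : δ < 1) (hε : 0 < ε)
    (h : (p : ℝ) / n ≥ fieldConstant q b M N s * (r / (δ ^ (1 / q) * ε ^ 2))) :
    (√(p : ℝ))⁻¹ ≤ ε := by
  have hp0 : (0 : ℝ) < p := by exact_mod_cast hp
  have hn1 : (1 : ℝ) ≤ n := by exact_mod_cast hn
  have hc : 1 ≤ fieldConstant q b M N s := by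
    unfold fieldConstant
    rw [add_assoc]
    exact le_add_of_nonneg_right (by positivity)
  have hδq0 : 0 < δ ^ (1 / q) := Real.rpow_pos_of_pos hδ _
  have hδq : δ ^ (1 / q) ≤ 1 := Real.rpow_le_one hδ.le hδ1.le (by positivity)
  have h1 : 1 / ε ^ 2 ≤ p := by
    calc 1 / ε ^ 2 ≤ r / (δ ^ (1 / q) * ε ^ 2) := by
          refine div_le_div₀ (by linarith) hr (by positivity) ?_
          exact mul_le_of_le_one_left (sq_nonneg ε) hδq
      _ ≤ fieldConstant q b M N s * (r / (δ ^ (1 / q) * ε ^ 2)) :=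
          le_mul_of_one_le_left (by positivity) hc
      _ ≤ p / n := h
      _ ≤ p := div_le_self hp0.le hn1
  have h2 : 1 / ε ≤ √(p : ℝ) := by
    refine Real.le_sqrt_of_sq_le ?_
    rwa [div_pow, one_pow]
  rw [← one_div, div_le_iff₀ (Real.sqrt_pos.2 hp0)]
  rwa [div_le_iff₀ hε, mul_comm] at h2

/-- The Frobenius distance of `B` from the rotation of `A` which applies `Q` to every row. -/
def alignmentError {n r : ℕ} (A B : Matrix (Fin n) (Fin r) ℝ)
    (Q : Matrix.orthogonalGroup (Fin r) ℝ) : ℝ :=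
  √(∑ i, ∑ k, ((A * (Q : Matrix (Fin r) (Fin r) ℝ)ᵀ) i k - B i k) ^ 2)

theorem continuous_alignmentError {n r : ℕ} (A B : Matrix (Fin n) (Fin r) ℝ) :
    Continuous (alignmentError A B) := by
  refine Real.continuous_sqrt.comp (continuous_finsetSum _ fun i _ =>
    continuous_finsetSum _ fun k _ => ?_)
  have h1 : Continuous fun Q : Matrix.orthogonalGroup (Fin r) ℝ =>
      A * (Q : Matrix (Fin r) (Fin r) ℝ)ᵀ :=
    continuous_const.matrix_mul continuous_subtype_val.matrix_transpose
  exact ((h1.matrix_elem i k).sub continuous_const).pow 2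

theorem norm_score_sub_le {n p r : ℕ} (Y : Matrix (Fin n) (Fin p) ℝ)
    (V : Matrix (Fin p) (Fin r) ℝ) {𝒵 : Type*} (lam : ℕ → ℝ) (u : ℕ → 𝒵 → ℝ) (z : Fin n → 𝒵)
    (Q : Matrix.orthogonalGroup (Fin r) ℝ) (i : Fin n) :
    ‖(√(p : ℝ))⁻¹ • (WithLp.toLp 2 ((Q : Matrix (Fin r) (Fin r) ℝ) *ᵥ pcScore Y V i) :
      EuclideanSpace ℝ (Fin r)) - featureMap lam u r (z i)‖ ≤
      alignmentError (scaledScores Y V) (featureMatrix lam u r z) Q := by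
  rw [EuclideanSpace.norm_eq, alignmentError]
  refine Real.sqrt_le_sqrt ?_
  refine le_trans (le_of_eq ?_) (Finset.single_le_sum (f := fun i => ∑ k,
    ((scaledScores Y V * (Q : Matrix (Fin r) (Fin r) ℝ)ᵀ) i k - featureMatrix lam u r z i k) ^ 2)
    (fun i _ => Finset.sum_nonneg fun k _ => sq_nonneg _) (Finset.mem_univ i))
  refine Finset.sum_congr rfl fun k _ => ?_
  rw [Real.norm_eq_abs, sq_abs]
  have e : (scaledScores Y V * (Q : Matrix (Fin r) (Fin r) ℝ)ᵀ) i k =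
      (√(p : ℝ))⁻¹ * ((Q : Matrix (Fin r) (Fin r) ℝ) *ᵥ pcScore Y V i) k := by
    simp only [scaledScores, Matrix.smul_mul, Matrix.smul_apply, smul_eq_mul,
      Matrix.mul_apply (M := Y * V), Matrix.mulVec, dotProduct, pcScore, Matrix.transpose_apply]
    congr 1
    exact Finset.sum_congr rfl fun l _ => mul_comm _ _
  rw [e]
  rfl

end Conclusion

end LatentMetricSpace

end

open LatentMetricSpace in
theorem theorem1 :
    -- `c₂` is a function of `q, λ₁, λᵣ`, the two moments and `σ²` only
    ∃ c₂ : ℝ → ℝ → ℝ → ℝ → ℝ → ℝ → ℝ, (∀ q a b M N s, 0 < c₂ q a b M N s) ∧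
    ∀ (𝒵 : Type*) [MetricSpace 𝒵] [CompactSpace 𝒵] [MeasurableSpace 𝒵] [BorelSpace 𝒵]
      (f : 𝒵 → 𝒵 → ℝ),
    -- `c₁` is a function of `f, λ₁, λᵣ` only
    ∃ c₁ : ℝ → ℝ → ℝ, (∀ a b, 0 < c₁ a b) ∧
    ∀ (Ω : Type*) [MeasurableSpace Ω] (P : Measure Ω) [IsProbabilityMeasure P]
      (μ : Measure 𝒵) [IsProbabilityMeasure μ]
      (n p r : ℕ) (_ : 1 ≤ r) (_ : r ≤ n) (hrp : r ≤ p)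
      (Z : Fin n → Ω → 𝒵) (X : Fin p → 𝒵 → Ω → ℝ) (E : Fin n → Fin p → Ω → ℝ)
      (σ : ℝ) (_ : 0 ≤ σ) (_ : IsModel P μ Z X E)
      (_ : f = meanCorrelationKernel P X)
      (_ : ∀ j, Continuous fun a : 𝒵 × 𝒵 => ∫ ω, X j a.1 ω * X j a.2 ω ∂P)
      (q : ℝ) (_ : 1 ≤ q)
      (_ : fieldMoment P X (4 * q) < ∞) (_ : noiseMoment P E (4 * q) < ∞)
      (lam : ℕ → ℝ) (u : ℕ → 𝒵 → ℝ) (_ : IsMercerExpansion μ f lam u) (_ : HasRank lam r)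
      (V : Ω → Matrix (Fin p) (Fin r) ℝ) (_ : ∀ a b, Measurable fun ω => V ω a b)
      (_ : ∀ ω, IsTopEigenvectors hrp (dataMatrix σ Z X E ω) (V ω)),
    ∃ Q : Ω → Matrix (Fin r) (Fin r) ℝ,
      (∀ a b, Measurable fun ω => Q ω a b) ∧
      (∀ ω, Q ω ∈ Matrix.orthogonalGroup (Fin r) ℝ) ∧
      ∀ δ : ℝ, 0 < δ → δ < 1 → ∀ ε : ℝ, 0 < ε → ε ≤ 1 →
        (n : ℝ) ≥ c₁ (lam 0) (lam (r - 1)) *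
          max (σ ^ 2 * √r * max 1 (σ ^ 2 * √r / ε ^ 2)) (Real.log (r / δ)) →
        (p : ℝ) / n ≥ c₂ q (lam 0) (lam (r - 1)) (fieldMoment P X (4 * q)).toReal
          (noiseMoment P E (4 * q)).toReal (σ ^ 2) * (r / (δ ^ (1 / q) * ε ^ 2)) →
        ENNReal.ofReal (1 - δ) ≤
          P {ω | ∀ i, ‖(√(p : ℝ))⁻¹ •
              (WithLp.toLp 2 (Q ω *ᵥ pcScore (dataMatrix σ Z X E ω) (V ω) i) :
                EuclideanSpace ℝ (Fin r)) - featureMap lam u r (Z i ω)‖ ≤ ε} := by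
  refine ⟨fun q _ b M N s => fieldConstant q b M N s,
    fun q _ b M N s => fieldConstant_pos q b M N s, ?_⟩
  intro 𝒵 _ _ _ _ f
  refine ⟨fun _ b => latentConstant f b, fun _ b => latentConstant_pos f b, ?_⟩
  intro Ω _ P _ μ _ n p r hr1 hrn hrp Z X E σ _ h hf hcont q hq hM hN lam u hu hr V hVm hV
  subst hf
  have hn : 1 ≤ n := hr1.trans hrn
  have hp : 0 < p := by omega
  have hfc : Continuous fun a : 𝒵 × 𝒵 => meanCorrelationKernel P X a.1 a.2 :=
    continuous_const.mul (continuous_finsetSum _ fun j _ => hcont j)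
  have hum : ∀ k : Fin r, Measurable (u k) := fun k =>
    (hu.continuous_eigenfunction hr hfc (h.meanCorrelationKernel_diag_le hp hq hM) k).measurable
  set A : Ω → Matrix (Fin n) (Fin r) ℝ := fun ω => scaledScores (dataMatrix σ Z X E ω) (V ω) with hA
  set B : Ω → Matrix (Fin n) (Fin r) ℝ := fun ω => featureMatrix lam u r (fun i => Z i ω) with hB
  have hAm : ∀ i k, Measurable fun ω => A ω i k := fun i k => by
    simp only [hA, scaledScores, Matrix.smul_apply, Matrix.mul_apply, smul_eq_mul]
    exact (Finset.measurable_sum _ fun j _ =>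
      (h.measurable_dataMatrix i j).mul (hVm j k)).const_mul _
  have hBm : ∀ i k, Measurable fun ω => B ω i k := fun i k =>
    ((hum k).comp (h.measurable_latent i)).const_mul _
  have hGm : ∀ Q, Measurable fun ω => alignmentError (A ω) (B ω) Q := fun Q => by
    refine Measurable.sqrt (Finset.measurable_sum _ fun i _ =>
      Finset.measurable_sum _ fun k _ => ?_)
    simp only [Matrix.mul_apply]
    exact ((Finset.measurable_sum _ fun l _ => (hAm i l).mul_const _).sub (hBm i k)).pow_const 2
  -- the slack must be independent of `ε`, and below `ε / 2` for every admissible `ε`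
  have hη : 0 < (√(p : ℝ))⁻¹ / 2 := by
    have : 0 < √(p : ℝ) := Real.sqrt_pos.2 (by exact_mod_cast hp)
    positivity
  have : SecondCountableTopology (Matrix (Fin r) (Fin r) ℝ) :=
    inferInstanceAs (SecondCountableTopology (Fin r → Fin r → ℝ))
  have : SecondCountableTopology (Matrix.orthogonalGroup (Fin r) ℝ) :=
    TopologicalSpace.Subtype.secondCountableTopology _
  obtain ⟨d, K, hK, hmin⟩ := exists_measurable_near_minimizer
    (fun ω => continuous_alignmentError (A ω) (B ω)) hGm (fun Q ω => Real.sqrt_nonneg _) hη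
  refine ⟨fun ω => d (K ω), fun a b => ?_, fun ω => (d (K ω)).2, ?_⟩
  · exact (measurable_from_nat (f := fun k => (d k : Matrix (Fin r) (Fin r) ℝ) a b)).comp hK
  intro δ hδ hδ1 ε hε hε1 hnc hpc
  have hbad := h.measure_no_alignment_le hr1 hn hq hM hN hfc.measurable hu hr hum hV hδ hδ1 hε hε1
    hnc hpc
  have hεp := inv_sqrt_le_of_fieldConstant (by exact_mod_cast hr1) hn hp hq hδ hδ1 hε hpc
  set bad : Set Ω := {ω | ¬ ∃ Q ∈ Matrix.orthogonalGroup (Fin r) ℝ, ∑ i, ∑ k,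
      ((scaledScores (dataMatrix σ Z X E ω) (V ω) * Qᵀ) i k -
        featureMatrix lam u r (fun i => Z i ω) i k) ^ 2 ≤ (ε / 2) ^ 2} with hbaddef
  set good : Set Ω := {ω | ∀ i, ‖(√(p : ℝ))⁻¹ •
      (WithLp.toLp 2 ((d (K ω) : Matrix (Fin r) (Fin r) ℝ) *ᵥ
        pcScore (dataMatrix σ Z X E ω) (V ω) i) : EuclideanSpace ℝ (Fin r)) -
          featureMap lam u r (Z i ω)‖ ≤ ε} with hgooddef
  -- subadditivity of the outer measure `P` avoids measurability of the two events
  have hcover : Set.univ ⊆ good ∪ bad := by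
    intro ω _
    by_cases hω : ω ∈ bad
    · exact Or.inr hω
    left
    obtain ⟨Q, hQ, hle⟩ := not_not.1 hω
    intro i
    have h1 := norm_score_sub_le (dataMatrix σ Z X E ω) (V ω) lam u (fun i => Z i ω) (d (K ω)) i
    have h2 := hmin ω ⟨Q, hQ⟩
    have h3 : alignmentError (A ω) (B ω) ⟨Q, hQ⟩ ≤ ε / 2 :=
      Real.sqrt_le_iff.2 ⟨by positivity, hle⟩
    refine h1.trans (h2.le.trans ?_)
    linarith
  rw [ENNReal.ofReal_sub 1 hδ.le, ENNReal.ofReal_one, tsub_le_iff_right, ← measure_univ (μ := P)]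
  calc P Set.univ ≤ P (good ∪ bad) := measure_mono hcover
    _ ≤ P good + P bad := measure_union_le _ _
    _ ≤ _ := add_le_add le_rfl hbad
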